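/- **Setting.** Fix a probability space $(\Omega,\mathcal F,P)$ and $\Sigma=\{1,\dots,d\}$; all processes are indexed by $\mathbb Z$, and equalities of random variables hold almost surely. $\Sigma^+$ denotes the nonempty words over $\Sigma$, and $\epsilon$ is the empty word. For an $\mathbb R^d$-valued process $\mu$ and $w=\sigma_1\cdots\sigma_k$ put $\mu_w(t)=\mu_{\sigma_1}(t-k+1)\cdots\mu_{\sigma_k}(t)$, with $\mu_\epsilon=1$. Let $\mathcal F_t^{\mu,-}$ and $\mathcal F_t^{\mu,+}$ be the $\sigma$-algebras generated by $\{\mu(k)\}_{k<t}$ and $\{\mu(k)\}_{k\ge t}$. The switching process $\mu$ is *admissible*, with $\mathcal E\subseteq\Sigma\times\Sigma$ and positive numbers $(p_\sigma)_{\sigma\in\Sigma}$, if, with $L=\{\sigma_1\cdots\sigma_k\in\Sigma^+ : (\sigma_i,\sigma_{i+1})\in\mathcal E \text{ for } 1\le i<k\}$: 1. every $\sigma\in\Sigma$ has some $\sigma'$ with $(\sigma,\sigma')\in\mathcal E$, and $\mu_w=0$ for $w\in\Sigma^+\setminus L$; 2. for all $w,v\in\Sigma^+$, $\sigma,\sigma'\in\Sigma$,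 $t\in\mathbb Z$: $E[\mu_{w\sigma}(t)\mu_{v\sigma'}(t)\mid\mathcal F_t^{\mu,-}]$ equals $p_\sigma\mu_w(t-1)\mu_v(t-1)$ if $\sigma=\sigma'$ and $w\sigma,v\sigma\in L$, and $0$ otherwise; $E[\mu_{w\sigma}(t)\mu_{\sigma'}(t)\mid\mathcal F_t^{\mu,-}]$ equals $p_\sigma\mu_w(t-1)$ if $\sigma=\sigma'$ and $w\sigma\in L$, and $0$ otherwise; and $E[\mu_\sigma(t)\mu_{\sigma'}(t)\mid\mathcal F_t^{\mu,-}]=0$ if $\sigma\neq\sigma'$; 3. there are reals $\alpha_\sigma$ with $\sum_\sigma\alpha_\sigma\mu_\sigma(t)=1$ for all $t$; 4. for all $w,v\in\Sigma^+$ the process $(\mu_w,\mu_v)$ is wide-sense stationary. For a vector process $r$ put $p_w=p_{\sigma_1}\cdots p_{\sigma_k}$ and $z^r_w(t)=r(t-|w|)\,\mu_w(t-1)/\sqrt{p_w}$. The process $r$ is *ZMWSSI* if, for each $t$, the $\sigma$-algebra generated by $\{r(k)\}_{k\le t}$ and $\mathcal F_t^{\mu,+}$ are conditionally independent given $\mathcal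 F_t^{\mu,-}$, and the processes $r$, $z_w^r$ $(w\in\Sigma^+)$ are zero mean, square integrable and jointly wide-sense stationary. A ZMWSSI process $r$ is a *possibly degenerate white noise w.r.t. $\mu$* if for all $w\in\Sigma^+$, $\sigma\in\Sigma$ and all (possibly empty) words $v$, $E[z^r_w(t)z^r_{\sigma v}(t)^T]$ equals $E[z^r_\sigma(t)z^r_\sigma(t)^T]$ if $w=\sigma v\in L$, and $0$ otherwise. It is a *white noise w.r.t. $\mu$* if moreover all the matrices $E[z^r_\sigma(t)z^r_\sigma(t)^T]$ are nonsingular. A *stationary GLSS of $(y,u,\mu)$* consists of real matrices $A_\sigma,B_\sigma,K_\sigma$ $(\sigma\in\Sigma)$, $C,D,F$ and processes $x,v$ such that for all $t$ $$x(t+1)=\sum_{\sigma\in\Sigma}\big(A_\sigma x(t)+B_\sigma u(t)+K_\sigma v(t)\big)\mu_\sigma(t),\qquad y(t)=Cx(t)+Du(t)+Fv(t),$$ and, with $\eta=[v^T,u^T]^T$: (i) $\eta$ is a white noise w.r.t. $\mu$ and $E[v(t)u(t)^T\mu_\sigma(t)^2]=0$ for all $\sigma$; (ii) $[x^T,\eta^T]^T$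 is ZMWSSI, $E[z^x_\sigma(t)z^\eta_\sigma(t)^T]=0$ for all $\sigma\in\Sigma$, and $E[z^x_w(t)\eta(t)^T]=0$ for all $w\in\Sigma^+$; (iii) all eigenvalues of $\sum_\sigma p_\sigma A_\sigma\otimes A_\sigma$ lie in the open unit disc; (iv) if $(\sigma_1,\sigma_2)\notin\mathcal E$, then $A_{\sigma_2}A_{\sigma_1}=0$ and $A_{\sigma_2}[K_{\sigma_1}\ B_{\sigma_1}]\,E[z^\eta_{\sigma_1}(t)z^\eta_{\sigma_1}(t)^T]=0$. If in (i) the white noise $\eta$ is only possibly degenerate, we speak of a *possibly degenerate stationary GLSS*. For a set $G$ of square integrable random vectors, $E_l[z\mid G]$ denotes the coordinatewise orthogonal projection of $z$ in $L^2(P)$ onto the closed subspace generated by the coordinates of the elements of $G$. Put $$y^d(t)=E_l\big[y(t)\mid\{z^u_w(t)\}_{w\in\Sigma^+}\cup\{u(t)\}\big],\quad y^s=y-y^d,\quad e^s(t)=y^s(t)-E_l\big[y^s(t)\mid\{z^{y^s}_w(t)\}_{w\in\Sigma^+}\big].$$ A (possibly degenerate) stationary GLSS of $(y,u,\mu)$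 is *in innovation form* if $F=I$ and $v=e^s$. **Corollary (existence of an innovation form).** Let $\mu$ be admissible. For every possibly degenerate stationary GLSS of $(y,u,\mu)$ there exists a possibly degenerate stationary GLSS of $(y,u,\mu)$ in innovation form. If the given system is a stationary GLSS (with nonsingular noise covariances) and $E[e^s(t)e^s(t)^T\mu_\sigma(t)^2]$ is nonsingular for all $\sigma\in\Sigma$ and $t\in\mathbb Z$, then the latter system is a stationary GLSS as well. -/

import Mathlib

open MeasureTheory ProbabilityTheory
open scoped Kronecker Matrix

noncomputable section

namespace GLSSTheory

variable {Ω : Type*} [MeasurableSpace Ω]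

/-! Vector valued processes on the time axis `ℤ` are functions `ℤ → Ω → ι → ℝ`. Words over the
alphabet `Fin d` are lists of letters; the empty word is `[]`, and `σ₁ ⋯ σₖ` is `[σ₁, …, σₖ]`. -/

/-- The set of admissible words `L`: nonempty words all of whose consecutive pairs lie in `E`. -/
def AdmissibleWord {d : ℕ} (E : Set (Fin d × Fin d)) (w : List (Fin d)) : Prop :=
  w ≠ [] ∧ w.IsChain (fun a b => (a, b) ∈ E)

/-- `μ_w(t) = μ_{σ₁}(t-k+1) ⋯ μ_{σₖ}(t)` for `w = σ₁ ⋯ σₖ`, and `μ_ε(t) = 1`. -/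
def muWord {d : ℕ} (μ : ℤ → Ω → Fin d → ℝ) : List (Fin d) → ℤ → Ω → ℝ
  | [], _, _ => 1
  | σ :: w, t, ω => μ (t - w.length) ω σ * muWord μ w t ω

/-- `p_w = p_{σ₁} ⋯ p_{σₖ}`, with `p_ε = 1`. -/
def pWord {d : ℕ} (p : Fin d → ℝ) (w : List (Fin d)) : ℝ := (w.map p).prod

/-- `z^r_w(t) = r(t-|w|) μ_w(t-1) / √p_w`. For the empty word this is `r(t)`. -/
def zProc {d : ℕ} {ι : Type*} (μ : ℤ → Ω → Fin d → ℝ) (p : Fin d → ℝ)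
    (r : ℤ → Ω → ι → ℝ) (w : List (Fin d)) (t : ℤ) (ω : Ω) : ι → ℝ :=
  fun i => r (t - w.length) ω i * muWord μ w (t - 1) ω * (1 / Real.sqrt (pWord p w))

/-- The matrix `E[a bᵀ]`. -/
def crossCov {ι κ : Type*} (P : Measure Ω) (a : Ω → ι → ℝ) (b : Ω → κ → ℝ) : Matrix ι κ ℝ :=
  Matrix.of fun i j => ∫ ω, a ω i * b ω j ∂P

/-- The σ-algebra generated by `r(k)`, `k ∈ T`. -/
abbrev sigmaGen {ι : Type*} (r : ℤ → Ω → ι → ℝ) (T : Set ℤ) : MeasurableSpace Ω :=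
  ⨆ k ∈ T, MeasurableSpace.comap (r k) MeasurableSpace.pi

/-- Conditional independence of `m₁` and `m₂` given `m`, on an arbitrary probability space (the
notion in Mathlib asks for a standard Borel space). -/
def CondIndepGiven (P : Measure Ω) (m m₁ m₂ : MeasurableSpace Ω) : Prop :=
  ∀ s t : Set Ω, MeasurableSet[m₁] s → MeasurableSet[m₂] t →
    P[(s ∩ t).indicator (fun _ => (1 : ℝ)) | m] =ᵐ[P]
      P[s.indicator (fun _ => (1 : ℝ)) | m] * P[t.indicator (fun _ => (1 : ℝ)) | m]

/-- A family of real processes is jointly wide-sense stationary: square integrable, with constant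
means and shift invariant second moments. -/
structure JointlyWSS {κ : Type*} (P : Measure Ω) (f : κ → ℤ → Ω → ℝ) : Prop where
  memLp : ∀ i t, MemLp (f i t) 2 P
  mean : ∀ i t s, ∫ ω, f i t ω ∂P = ∫ ω, f i s ω ∂P
  cov : ∀ i j t s h,
    ∫ ω, f i (t + h) ω * f j (s + h) ω ∂P = ∫ ω, f i t ω * f j s ω ∂P

open Classical in
/-- Admissibility of the switching process `μ` with admissible pairs `E` and constants `p`. -/
structure IsAdmissible {d : ℕ} (P : Measure Ω) (μ : ℤ → Ω → Fin d → ℝ)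
    (E : Set (Fin d × Fin d)) (p : Fin d → ℝ) : Prop where
  measurable : ∀ t, Measurable (μ t)
  exists_succ : ∀ σ, ∃ σ', (σ, σ') ∈ E
  eq_zero : ∀ w, w ≠ [] → ¬ AdmissibleWord E w → ∀ t, muWord μ w t =ᵐ[P] 0
  p_pos : ∀ σ, 0 < p σ
  condExp_word_word : ∀ (w v : List (Fin d)), w ≠ [] → v ≠ [] → ∀ (σ σ' : Fin d) (t : ℤ),
    P[fun ω => muWord μ (w ++ [σ]) t ω * muWord μ (v ++ [σ']) t ω | sigmaGen μ (Set.Iio t)]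
      =ᵐ[P] if σ = σ' ∧ AdmissibleWord E (w ++ [σ]) ∧ AdmissibleWord E (v ++ [σ])
        then fun ω => p σ * (muWord μ w (t - 1) ω * muWord μ v (t - 1) ω) else 0
  condExp_word_letter : ∀ w : List (Fin d), w ≠ [] → ∀ (σ σ' : Fin d) (t : ℤ),
    P[fun ω => muWord μ (w ++ [σ]) t ω * μ t ω σ' | sigmaGen μ (Set.Iio t)]
      =ᵐ[P] if σ = σ' ∧ AdmissibleWord E (w ++ [σ])
        then fun ω => p σ * muWord μ w (t - 1) ω else 0
  condExp_letter_letter : ∀ (σ σ' : Fin d) (t : ℤ), σ ≠ σ' →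
    P[fun ω => μ t ω σ * μ t ω σ' | sigmaGen μ (Set.Iio t)] =ᵐ[P] 0
  exists_sum_eq_one : ∃ α : Fin d → ℝ, ∀ t, ∀ᵐ ω ∂P, ∑ σ, α σ * μ t ω σ = 1
  wss : ∀ w v : List (Fin d), w ≠ [] → v ≠ [] →
    JointlyWSS P (fun (b : Bool) t ω => if b then muWord μ w t ω else muWord μ v t ω)

/-- `r` is zero mean wide-sense stationary with respect to the switching process. The word `w`
ranges over all words, the empty one giving the process `r` itself. -/
structure IsZMWSSI {d : ℕ} {ι : Type*} (P : Measure Ω) (μ : ℤ → Ω → Fin d → ℝ) (p : Fin d → ℝ)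
    (r : ℤ → Ω → ι → ℝ) : Prop where
  measurable : ∀ t, Measurable (r t)
  condIndep : ∀ t, CondIndepGiven P (sigmaGen μ (Set.Iio t))
    (sigmaGen r (Set.Iic t)) (sigmaGen μ (Set.Ici t))
  zero_mean : ∀ w t i, ∫ ω, zProc μ p r w t ω i ∂P = 0
  wss : JointlyWSS P (fun (k : List (Fin d) × ι) t ω => zProc μ p r k.1 t ω k.2)

open Classical in
/-- White noise with respect to the switching process, where the covariances
`E[z^r_σ (z^r_σ)ᵀ]` are allowed to be singular. -/
structure IsWhiteNoiseDegenerate {d : ℕ} {ι : Type*} (P : Measure Ω) (μ : ℤ → Ω → Fin d → ℝ)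
    (E : Set (Fin d × Fin d)) (p : Fin d → ℝ) (r : ℤ → Ω → ι → ℝ) : Prop where
  zmwssi : IsZMWSSI P μ p r
  cov : ∀ (w v : List (Fin d)) (σ : Fin d) (t : ℤ), w ≠ [] →
    crossCov P (zProc μ p r w t) (zProc μ p r (σ :: v) t) =
      if w = σ :: v ∧ AdmissibleWord E w
        then crossCov P (zProc μ p r [σ] t) (zProc μ p r [σ] t) else 0

/-- White noise with respect to the switching process. -/
structure IsWhiteNoise {d : ℕ} {ι : Type*} [Fintype ι] [DecidableEq ι] (P : Measure Ω)
    (μ : ℤ → Ω → Fin d → ℝ) (E : Set (Fin d × Fin d)) (p : Fin d → ℝ)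
    (r : ℤ → Ω → ι → ℝ) : Prop extends IsWhiteNoiseDegenerate P μ E p r where
  nonsingular : ∀ σ t, IsUnit (crossCov P (zProc μ p r [σ] t) (zProc μ p r [σ] t)).det

/-- The stacked process `[aᵀ, bᵀ]ᵀ`. -/
def stack {ι κ : Type*} (a : ℤ → Ω → ι → ℝ) (b : ℤ → Ω → κ → ℝ) : ℤ → Ω → ι ⊕ κ → ℝ :=
  fun t ω => Sum.elim (a t ω) (b t ω)

/-- The process `r(t) μ_σ(t)`. -/
def timesMu {d : ℕ} {ι : Type*} (μ : ℤ → Ω → Fin d → ℝ) (σ : Fin d) (r : ℤ → Ω → ι → ℝ) :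
    ℤ → Ω → ι → ℝ :=
  fun t ω i => r t ω i * μ t ω σ

/-- The matrices of a generalized linear switched system. -/
structure GLSS (d nx nu nn ny : ℕ) where
  A : Fin d → Matrix (Fin nx) (Fin nx) ℝ
  B : Fin d → Matrix (Fin nx) (Fin nu) ℝ
  K : Fin d → Matrix (Fin nx) (Fin nn) ℝ
  C : Matrix (Fin ny) (Fin nx) ℝ
  D : Matrix (Fin ny) (Fin nu) ℝ
  F : Matrix (Fin ny) (Fin nn) ℝ

/-- `(S, x, v)` is a stationary GLSS of `(y, u, μ)`, except that the covariances
`E[z^w_σ (z^w_σ)ᵀ]`, `w = [vᵀ, uᵀ]ᵀ`, are allowed to be singular. -/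
structure IsStationaryGLSSDegenerate {d nx nu nn ny : ℕ} (P : Measure Ω)
    (μ : ℤ → Ω → Fin d → ℝ) (E : Set (Fin d × Fin d)) (p : Fin d → ℝ)
    (y : ℤ → Ω → Fin ny → ℝ) (u : ℤ → Ω → Fin nu → ℝ)
    (S : GLSS d nx nu nn ny) (x : ℤ → Ω → Fin nx → ℝ) (v : ℤ → Ω → Fin nn → ℝ) : Prop where
  state_eq : ∀ t, ∀ᵐ ω ∂P,
    x (t + 1) ω = ∑ σ, μ t ω σ • (S.A σ *ᵥ x t ω + S.B σ *ᵥ u t ω + S.K σ *ᵥ v t ω)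
  output_eq : ∀ t, ∀ᵐ ω ∂P, y t ω = S.C *ᵥ x t ω + S.D *ᵥ u t ω + S.F *ᵥ v t ω
  whiteNoise : IsWhiteNoiseDegenerate P μ E p (stack v u)
  noise_input : ∀ σ t, crossCov P (timesMu μ σ v t) (timesMu μ σ u t) = 0
  zmwssi : IsZMWSSI P μ p (stack x (stack v u))
  state_noise : ∀ σ t,
    crossCov P (zProc μ p x [σ] t) (zProc μ p (stack v u) [σ] t) = 0
  past_state_noise : ∀ w t, w ≠ [] → crossCov P (zProc μ p x w t) (stack v u t) = 0
  stable : ∀ z ∈ spectrum ℂ ((∑ σ, p σ • (S.A σ ⊗ₖ S.A σ)).map (algebraMap ℝ ℂ)), ‖z‖ < 1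
  mul_eq_zero : ∀ σ₁ σ₂, (σ₁, σ₂) ∉ E → S.A σ₂ * S.A σ₁ = 0
  mul_noise_eq_zero : ∀ σ₁ σ₂, (σ₁, σ₂) ∉ E → ∀ t,
    S.A σ₂ * Matrix.fromCols (S.K σ₁) (S.B σ₁) *
      crossCov P (zProc μ p (stack v u) [σ₁] t) (zProc μ p (stack v u) [σ₁] t) = 0

/-- `(S, x, v)` is a stationary GLSS of `(y, u, μ)`: the noise `w = [vᵀ, uᵀ]ᵀ` is a white noise
with nonsingular covariances `E[z^w_σ (z^w_σ)ᵀ]`. -/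
structure IsStationaryGLSS {d nx nu nn ny : ℕ} (P : Measure Ω)
    (μ : ℤ → Ω → Fin d → ℝ) (E : Set (Fin d × Fin d)) (p : Fin d → ℝ)
    (y : ℤ → Ω → Fin ny → ℝ) (u : ℤ → Ω → Fin nu → ℝ)
    (S : GLSS d nx nu nn ny) (x : ℤ → Ω → Fin nx → ℝ) (v : ℤ → Ω → Fin nn → ℝ) : Prop
    extends IsStationaryGLSSDegenerate P μ E p y u S x v where
  regular : IsWhiteNoise P μ E p (stack v u)

/-- The closed subspace of `L²` generated by (the square integrable elements of) `G`. -/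
def closedSpan (P : Measure Ω) (G : Set (Ω → ℝ)) : Submodule ℝ (Lp ℝ 2 P) :=
  (Submodule.span ℝ {f : Lp ℝ 2 P | ∃ g ∈ G, f =ᵐ[P] g}).topologicalClosure

instance (P : Measure Ω) (G : Set (Ω → ℝ)) : CompleteSpace (closedSpan P G) :=
  (Submodule.isClosed_topologicalClosure _).completeSpace_coe

open Classical in
/-- The best linear prediction `E_l[z | G]`: the coordinatewise orthogonal projection in `L²` onto
the closed subspace generated by `G` (with value `0` on coordinates that are not in `L²`). -/
def linPred {ι : Type*} (P : Measure Ω) (G : Set (Ω → ℝ)) (z : Ω → ι → ℝ) : Ω → ι → ℝ :=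
  fun ω i => if h : MemLp (fun ω => z ω i) 2 P
    then ((closedSpan P G).starProjection (h.toLp _) : Lp ℝ 2 P) ω else 0

/-- The coordinates of a random vector. -/
def coords {ι : Type*} (z : Ω → ι → ℝ) : Set (Ω → ℝ) := {g | ∃ i, g = fun ω => z ω i}

/-- The coordinates of `z^r_w(t)`, for `w` a nonempty word. -/
def pastCoords {d : ℕ} {ι : Type*} (μ : ℤ → Ω → Fin d → ℝ) (p : Fin d → ℝ)
    (r : ℤ → Ω → ι → ℝ) (t : ℤ) : Set (Ω → ℝ) :=
  {g | ∃ w : List (Fin d), w ≠ [] ∧ g ∈ coords (zProc μ p r w t)}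

/-- The deterministic component `y^d`. -/
def detComp {d : ℕ} {ι κ : Type*} (P : Measure Ω) (μ : ℤ → Ω → Fin d → ℝ) (p : Fin d → ℝ)
    (y : ℤ → Ω → ι → ℝ) (u : ℤ → Ω → κ → ℝ) : ℤ → Ω → ι → ℝ :=
  fun t => linPred P (pastCoords μ p u t ∪ coords (u t)) (y t)

/-- The stochastic component `y^s = y - y^d`. -/
def stochComp {d : ℕ} {ι κ : Type*} (P : Measure Ω) (μ : ℤ → Ω → Fin d → ℝ) (p : Fin d → ℝ)
    (y : ℤ → Ω → ι → ℝ) (u : ℤ → Ω → κ → ℝ) : ℤ → Ω → ι → ℝ :=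
  fun t ω => y t ω - detComp P μ p y u t ω

/-- The innovation process `e^s(t) = y^s(t) - E_l[y^s(t) | z^{y^s}_w(t), w nonempty]`. -/
def innovation {d : ℕ} {ι κ : Type*} (P : Measure Ω) (μ : ℤ → Ω → Fin d → ℝ) (p : Fin d → ℝ)
    (y : ℤ → Ω → ι → ℝ) (u : ℤ → Ω → κ → ℝ) : ℤ → Ω → ι → ℝ :=
  fun t ω => stochComp P μ p y u t ω -
    linPred P (pastCoords μ p (stochComp P μ p y u) t) (stochComp P μ p y u t) ω

/-- A GLSS with noise `v` is in innovation form: `F = I` and `v = e^s`. -/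
def InInnovationForm {d nx nu ny : ℕ} (P : Measure Ω) (μ : ℤ → Ω → Fin d → ℝ) (p : Fin d → ℝ)
    (y : ℤ → Ω → Fin ny → ℝ) (u : ℤ → Ω → Fin nu → ℝ)
    (S : GLSS d nx nu ny ny) (v : ℤ → Ω → Fin ny → ℝ) : Prop :=
  S.F = 1 ∧ v = innovation P μ p y u

end GLSSTheory

end

/-! Stationarity removes time. The processes `z_w` of the stacked process `(x, v, u)` have shift
invariant second moments, so one Hilbert space `V`, read off at time `t` by an isometry `Φ t` into
`L²`, carries them all, and multiplication by `μ_σ(t) / √p_σ` followed by a unit shift becomes one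
operator `T σ` on `V` (`exists_processSpace`). Boundedness rests on two facts: given the past of
`μ`, the second moment of `μ_σ(t)` is at most `p_σ` (`condExp_sq_le`), and conditional independence
allows conditioning on the past of `(x, v, u)` as well (`condExp_history`). Admissibility turns into
four algebraic rules (`exists_isSwitchingFamily`). `T σ` need not be isometric, but an inner product
is either kept or annihilated by it once one of the vectors lies in the range of some `T τ`; so
orthogonality to a strict past survives `T σ`.

In `V` the claim is the Kalman filter. Projecting the state onto the strict past of the input gives
`x = xd + xs`, where each part obeys its own recursion and `xs` is orthogonal to every input word
(`exists_state_decomposition`). Hence `y^d = C xd + D u` and `y^s = C xs + F v`. Let `xh` be the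
projection of `xs` onto the strict past of `y^s`; the prediction of `y^s` is `C xh`, and the rest is
the innovation `e`. Choosing the new gain so that its multiple of `T σ e` is the projection of `T σ
(A xs + K v)` onto the span of the `T σ (e k)` makes `xh` satisfy the filter recursion, and `xd +
xh` is the new state (`exists_innovation`). `A`, `B`, `C`, `D` do not change, so stability is
inherited; the gain exists even if the covariance of `e` is singular. -/

namespace GLSSTheory

/-! ### Matrices acting on families of vectors -/

section LinearCombinations

variable {V W : Type*} [NormedAddCommGroup V] [InnerProductSpace ℝ V]
  [NormedAddCommGroup W] [InnerProductSpace ℝ W]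
  {l m n : Type*} [Fintype m] [Fintype n]

/-- The matrix `M` applied to a family of vectors. -/
def lc (M : Matrix l m ℝ) (x : m → V) (i : l) : V := ∑ j, M i j • x j

theorem lc_add (M : Matrix l m ℝ) (x y : m → V) (i : l) :
    lc M (fun j => x j + y j) i = lc M x i + lc M y i := by
  simp [lc, smul_add, Finset.sum_add_distrib]

theorem lc_sub (M : Matrix l m ℝ) (x y : m → V) (i : l) :
    lc M (fun j => x j - y j) i = lc M x i - lc M y i := by
  simp [lc, smul_sub, Finset.sum_sub_distrib]

theorem zero_lc (x : m → V) (i : l) : lc (0 : Matrix l m ℝ) x i = 0 := by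
  simp [lc]

theorem one_lc [DecidableEq m] (x : m → V) (i : m) : lc (1 : Matrix m m ℝ) x i = x i := by
  simp [lc, Matrix.one_apply]

theorem mul_lc (M : Matrix l m ℝ) (N : Matrix m n ℝ) (x : n → V) (i : l) :
    lc (M * N) x i = lc M (lc N x) i := by
  simp only [lc, Matrix.mul_apply, Finset.sum_smul, Finset.smul_sum, mul_smul]
  exact Finset.sum_comm

theorem fromCols_lc (M : Matrix l m ℝ) (N : Matrix l n ℝ) (x : m → V) (y : n → V) (i : l) :
    lc (Matrix.fromCols M N) (Sum.elim x y) i = lc M x i + lc N y i := by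
  simp [lc]

theorem map_lc (T : V →L[ℝ] W) (M : Matrix l m ℝ) (x : m → V) (i : l) :
    T (lc M x i) = lc M (fun j => T (x j)) i := by
  simp [lc]

theorem inner_lc_left (M : Matrix l m ℝ) (x : m → V) (i : l) (z : V) :
    inner ℝ (lc M x i) z = ∑ j, M i j * inner ℝ (x j) z := by
  simp [lc, sum_inner, inner_smul_left]

theorem lc_mem {N : Submodule ℝ V} (M : Matrix l m ℝ) {x : m → V} (hx : ∀ j, x j ∈ N) (i : l) :
    lc M x i ∈ N :=
  N.sum_mem fun j _ => N.smul_mem _ (hx j)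

theorem inner_lc_left_eq_zero (M : Matrix l m ℝ) {x : m → V} {z : V}
    (h : ∀ j, inner ℝ (x j) z = 0) (i : l) : inner ℝ (lc M x i) z = 0 := by
  rw [inner_lc_left]
  exact Finset.sum_eq_zero fun j _ => by rw [h, mul_zero]

/-- The normal equations are solvable without inverting a Gram matrix, because the span of finitely
many vectors admits an orthogonal projection. This supplies the filter gains. -/
theorem exists_lc_inner_eq_zero (f : V) (g : m → V) :
    ∃ c : m → ℝ, ∀ k, inner ℝ (f - ∑ j, c j • g j) (g k) = 0 := by
  have : FiniteDimensional ℝ (Submodule.span ℝ (Set.range g)) :=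
    FiniteDimensional.span_of_finite ℝ (Set.finite_range g)
  obtain ⟨c, hc⟩ := (Submodule.mem_span_range_iff_exists_fun ℝ).1
    (Submodule.starProjection_apply_mem (Submodule.span ℝ (Set.range g)) f)
  refine ⟨c, fun k => ?_⟩
  rw [hc]
  exact Submodule.starProjection_inner_eq_zero _ _ (Submodule.subset_span ⟨k, rfl⟩)

end LinearCombinations

/-! ### Orthogonality calculus for words of switching operators -/

section Switching

variable {V : Type*} [NormedAddCommGroup V] [InnerProductSpace ℝ V] {d : ℕ}

/-- The operator `T_{σₖ} ⋯ T_{σ₁}` attached to the word `σ₁ ⋯ σₖ`. -/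
def wordOp (T : Fin d → V →L[ℝ] V) (w : List (Fin d)) : V →L[ℝ] V :=
  w.foldl (fun S σ => (T σ).comp S) (ContinuousLinearMap.id ℝ V)

@[simp]
theorem wordOp_nil (T : Fin d → V →L[ℝ] V) (f : V) : wordOp T [] f = f := rfl

@[simp]
theorem wordOp_singleton (T : Fin d → V →L[ℝ] V) (σ : Fin d) (f : V) :
    wordOp T [σ] f = T σ f := rfl

@[simp]
theorem wordOp_append_singleton (T : Fin d → V →L[ℝ] V) (w : List (Fin d)) (σ : Fin d) (f : V) :
    wordOp T (w ++ [σ]) f = T σ (wordOp T w f) := by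
  simp [wordOp, List.foldl_append]

/-- The algebraic properties of multiplication by `μ_σ / √p_σ` followed by a time shift. -/
structure IsSwitchingFamily (T : Fin d → V →L[ℝ] V) (E : Set (Fin d × Fin d))
    (a : Fin d → ℝ) : Prop where
  inner_of_ne : ∀ σ σ' f g, σ ≠ σ' → inner ℝ (T σ f) (T σ' g) = 0
  inner_of_mem : ∀ τ σ f g, (τ, σ) ∈ E → inner ℝ (T σ (T τ f)) (T σ g) = inner ℝ (T τ f) g
  comp_of_notMem : ∀ τ σ f, (τ, σ) ∉ E → T σ (T τ f) = 0
  inner_eq_sum : ∀ f g, inner ℝ f g = ∑ σ, a σ * inner ℝ (T σ f) (T σ g)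

/-- The closed span of the vectors `T_w (R i)`, `w` nonempty. -/
def pastSpan {ι : Type*} (T : Fin d → V →L[ℝ] V) (R : ι → V) : Submodule ℝ V :=
  (Submodule.span ℝ {f | ∃ w : List (Fin d), w ≠ [] ∧ ∃ i, f = wordOp T w (R i)}).topologicalClosure

/-- The closed span of the vectors `T_w (R i)`, `w` an arbitrary word. -/
def fullSpan {ι : Type*} (T : Fin d → V →L[ℝ] V) (R : ι → V) : Submodule ℝ V :=
  (Submodule.span ℝ {f | ∃ w : List (Fin d), ∃ i, f = wordOp T w (R i)}).topologicalClosure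

theorem map_eq_zero_of_mem_closure_span {W : Type*} [NormedAddCommGroup W] [NormedSpace ℝ W]
    {s : Set V} (φ : V →L[ℝ] W) (h : ∀ f ∈ s, φ f = 0) {f : V}
    (hf : f ∈ (Submodule.span ℝ s).topologicalClosure) : φ f = 0 := by
  have : (Submodule.span ℝ s).topologicalClosure ≤ LinearMap.ker φ.toLinearMap :=
    Submodule.topologicalClosure_minimal _ (Submodule.span_le.2 fun f hf => h f hf)
      φ.isClosed_ker
  exact this hf

variable {T : Fin d → V →L[ℝ] V} {ι κ : Type*} {R : ι → V}

theorem wordOp_mem_pastSpan {w : List (Fin d)} (hw : w ≠ []) (i : ι) :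
    wordOp T w (R i) ∈ pastSpan T R :=
  Submodule.le_topologicalClosure _ (Submodule.subset_span ⟨w, hw, i, rfl⟩)

theorem wordOp_mem_fullSpan (w : List (Fin d)) (i : ι) : wordOp T w (R i) ∈ fullSpan T R :=
  Submodule.le_topologicalClosure _ (Submodule.subset_span ⟨w, i, rfl⟩)

theorem mem_fullSpan (i : ι) : R i ∈ fullSpan T R := wordOp_mem_fullSpan [] i

theorem pastSpan_le_fullSpan : pastSpan T R ≤ fullSpan T R :=
  Submodule.topologicalClosure_mono (Submodule.span_mono fun _ ⟨w, _, i, h⟩ => ⟨w, i, h⟩)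

theorem apply_mem_pastSpan (σ : Fin d) {f : V} (hf : f ∈ fullSpan T R) : T σ f ∈ pastSpan T R := by
  have : fullSpan T R ≤ (pastSpan T R).comap (T σ).toLinearMap := by
    refine Submodule.topologicalClosure_minimal _ (Submodule.span_le.2 ?_)
      ((Submodule.isClosed_topologicalClosure _).preimage (T σ).continuous)
    rintro _ ⟨w, i, rfl⟩
    change T σ (wordOp T w (R i)) ∈ pastSpan T R
    rw [← wordOp_append_singleton]
    exact wordOp_mem_pastSpan (by simp) i
  exact this hf

theorem wordOp_apply_mem_pastSpan {w : List (Fin d)} (hw : w ≠ []) {f : V}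
    (hf : f ∈ fullSpan T R) : wordOp T w f ∈ pastSpan T R := by
  induction w using List.reverseRecOn with
  | nil => exact absurd rfl hw
  | append_singleton w σ ih =>
    rw [wordOp_append_singleton]
    apply apply_mem_pastSpan
    rcases eq_or_ne w [] with rfl | h
    · exact hf
    · exact pastSpan_le_fullSpan (ih h)

theorem wordOp_apply_mem_fullSpan (w : List (Fin d)) {f : V}
    (hf : f ∈ fullSpan T R) : wordOp T w f ∈ fullSpan T R := by
  rcases eq_or_ne w [] with rfl | h
  · exact hf
  · exact pastSpan_le_fullSpan (wordOp_apply_mem_pastSpan h hf)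

theorem inner_eq_zero_of_mem_pastSpan {h f : V}
    (H : ∀ w : List (Fin d), w ≠ [] → ∀ i, inner ℝ h (wordOp T w (R i)) = 0)
    (hf : f ∈ pastSpan T R) : inner ℝ h f = 0 := by
  refine map_eq_zero_of_mem_closure_span (innerSL ℝ h) ?_ hf
  rintro _ ⟨w, hw, i, rfl⟩
  exact H w hw i

theorem inner_eq_zero_of_mem_fullSpan {h f : V}
    (H : ∀ (w : List (Fin d)) (i : ι), inner ℝ h (wordOp T w (R i)) = 0)
    (hf : f ∈ fullSpan T R) : inner ℝ h f = 0 := by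
  refine map_eq_zero_of_mem_closure_span (innerSL ℝ h) ?_ hf
  rintro _ ⟨w, i, rfl⟩
  exact H w i

theorem inner_fullSpan_fullSpan_eq_zero {R' : κ → V}
    (H : ∀ (w v : List (Fin d)) i j, inner ℝ (wordOp T w (R i)) (wordOp T v (R' j)) = 0)
    {f g : V} (hf : f ∈ fullSpan T R) (hg : g ∈ fullSpan T R') : inner ℝ f g = 0 := by
  refine inner_eq_zero_of_mem_fullSpan (fun v j => ?_) hg
  rw [real_inner_comm]
  exact inner_eq_zero_of_mem_fullSpan (fun w i => (real_inner_comm _ _).trans (H w v i j)) hf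

namespace IsSwitchingFamily

variable {E : Set (Fin d × Fin d)} {a : Fin d → ℝ} (hT : IsSwitchingFamily T E a)
include hT

/-- For an admissible pair `T σ` keeps the inner product, and otherwise it kills the left vector.
The inner `T τ` is essential: on arbitrary vectors `T σ` need not preserve orthogonality. -/
theorem inner_apply_comp_eq_zero {τ σ : Fin d} {f g : V} (h : inner ℝ (T τ f) g = 0) :
    inner ℝ (T σ (T τ f)) (T σ g) = 0 := by
  by_cases hE : (τ, σ) ∈ E
  · rw [hT.inner_of_mem _ _ _ _ hE, h]
  · rw [hT.comp_of_notMem _ _ _ hE, inner_zero_left]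

theorem inner_apply_wordOp_eq_zero {w : List (Fin d)} (hw : w ≠ []) {σ : Fin d} {f g : V}
    (h : inner ℝ (wordOp T w f) g = 0) : inner ℝ (T σ (wordOp T w f)) (T σ g) = 0 := by
  obtain rfl | ⟨w, τ, rfl⟩ := List.eq_nil_or_concat' w
  · exact absurd rfl hw
  · rw [wordOp_append_singleton] at h ⊢
    exact hT.inner_apply_comp_eq_zero h

/-- Here `h` is arbitrary: it is enough that the generators of the past span lie in ranges of the
operators. Continuity passes to the closure. -/
theorem inner_apply_eq_zero_of_mem_pastSpan {σ : Fin d} {h f : V}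
    (H : ∀ w : List (Fin d), w ≠ [] → ∀ i, inner ℝ h (wordOp T w (R i)) = 0)
    (hf : f ∈ pastSpan T R) : inner ℝ (T σ h) (T σ f) = 0 := by
  refine map_eq_zero_of_mem_closure_span ((innerSL ℝ (T σ h)).comp (T σ)) ?_ hf
  rintro _ ⟨w, hw, i, rfl⟩
  change inner ℝ (T σ h) (T σ (wordOp T w (R i))) = 0
  rw [real_inner_comm]
  refine hT.inner_apply_wordOp_eq_zero hw ?_
  rw [real_inner_comm, H w hw i]

/-- Inner products are recovered from their images one step later, which is where the relation `∑
α_σ μ_σ = 1` enters. -/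
theorem inner_eq_zero_of_forall_apply {f g : V} (h : ∀ σ, inner ℝ (T σ f) (T σ g) = 0) :
    inner ℝ f g = 0 := by
  rw [hT.inner_eq_sum]
  exact Finset.sum_eq_zero fun σ _ => by rw [h, mul_zero]

/-- Common last letters are peeled off. Distinct words end up either with different last letters,
hence orthogonal ranges, or with one word exhausted, which is the case of the hypotheses. -/
theorem inner_wordOp_eq_zero_of_ne {f g : V}
    (hfg : ∀ w : List (Fin d), w ≠ [] → inner ℝ f (wordOp T w g) = 0)
    (hgf : ∀ w : List (Fin d), w ≠ [] → inner ℝ (wordOp T w f) g = 0)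
    {w v : List (Fin d)} (hwv : w ≠ v) : inner ℝ (wordOp T w f) (wordOp T v g) = 0 := by
  induction w using List.reverseRecOn generalizing v with
  | nil => exact hfg v hwv.symm
  | append_singleton w σ ih =>
    obtain rfl | ⟨v, τ, rfl⟩ := List.eq_nil_or_concat' v
    · exact hgf _ (by simp)
    simp only [wordOp_append_singleton]
    by_cases hστ : σ = τ
    · subst hστ
      have hne : w ≠ v := fun h => hwv (by rw [h])
      rcases eq_or_ne w [] with rfl | hw
      · rw [real_inner_comm]
        refine hT.inner_apply_wordOp_eq_zero hne.symm ?_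
        rw [real_inner_comm]
        exact hfg v hne.symm
      · exact hT.inner_apply_wordOp_eq_zero hw (ih hne)
    · exact hT.inner_of_ne _ _ _ _ hστ

/-- Equal words are peeled down to a single letter, where `h` applies; the empty word follows from
the single letters by `inner_eq_sum`. -/
theorem inner_wordOp_eq_zero {f g : V} (h : ∀ σ, inner ℝ (T σ f) (T σ g) = 0)
    (hfg : ∀ w : List (Fin d), w ≠ [] → inner ℝ f (wordOp T w g) = 0)
    (hgf : ∀ w : List (Fin d), w ≠ [] → inner ℝ (wordOp T w f) g = 0)
    (w v : List (Fin d)) : inner ℝ (wordOp T w f) (wordOp T v g) = 0 := by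
  rcases eq_or_ne w v with rfl | hwv
  swap
  · exact hT.inner_wordOp_eq_zero_of_ne hfg hgf hwv
  induction w using List.reverseRecOn with
  | nil => exact hT.inner_eq_zero_of_forall_apply h
  | append_singleton w σ ih =>
    simp only [wordOp_append_singleton]
    rcases eq_or_ne w [] with rfl | hw
    · exact h σ
    · exact hT.inner_apply_wordOp_eq_zero hw ih

theorem wordOp_eq_zero_of_not_isChain {w : List (Fin d)}
    (hw : ¬ w.IsChain fun a b => (a, b) ∈ E) (f : V) : wordOp T w f = 0 := by
  induction w using List.reverseRecOn with
  | nil => simp at hw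
  | append_singleton w σ ih =>
    by_cases h : w.IsChain fun a b => (a, b) ∈ E
    · obtain rfl | ⟨w, τ, rfl⟩ := List.eq_nil_or_concat' w
      · simp at hw
      simp only [wordOp_append_singleton]
      refine hT.comp_of_notMem _ _ _ fun hE => hw ?_
      rw [List.isChain_append]
      exact ⟨h, by simp, by simpa using hE⟩
    · rw [wordOp_append_singleton, ih h, map_zero]

/-- Only the first letter can change the inner product: each later one acts on vectors in the range
of its predecessor, along a pair in `E`. -/
theorem inner_wordOp_cons_self {σ : Fin d} {w : List (Fin d)}
    (hw : (σ :: w).IsChain fun a b => (a, b) ∈ E) (f g : V) :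
    inner ℝ (wordOp T (σ :: w) f) (wordOp T (σ :: w) g) = inner ℝ (T σ f) (T σ g) := by
  induction w using List.reverseRecOn with
  | nil => rfl
  | append_singleton w τ ih =>
    rw [← List.cons_append] at hw ⊢
    rw [List.isChain_append] at hw
    rw [← ih hw.1, wordOp_append_singleton, wordOp_append_singleton]
    obtain h | ⟨v, ρ, h⟩ := List.eq_nil_or_concat' (σ :: w)
    · simp at h
    rw [h] at hw ⊢
    simp only [wordOp_append_singleton]
    exact hT.inner_of_mem _ _ _ _ (by simpa using hw.2.2)

end IsSwitchingFamily

end Switching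

/-! ### The Kalman filter in the time free Hilbert space -/

section Realization

variable {V : Type*} [NormedAddCommGroup V] [InnerProductSpace ℝ V] {d nx nu nn ny : ℕ}

/-- The time free form of a stationary GLSS: the processes are vectors of a Hilbert space on which
the switching process acts by the operators `T σ`. -/
structure IsRealization (T : Fin d → V →L[ℝ] V) (E : Set (Fin d × Fin d)) (c : Fin d → ℝ)
    (y : Fin ny → V) (u : Fin nu → V) (S : GLSS d nx nu nn ny) (x : Fin nx → V)
    (v : Fin nn → V) : Prop where
  state_eq : ∀ i, x i = ∑ σ, c σ • T σ (lc (S.A σ) x i + lc (S.B σ) u i + lc (S.K σ) v i)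
  output_eq : ∀ i, y i = lc S.C x i + lc S.D u i + lc S.F v i
  white : ∀ w w' : List (Fin d), w ≠ [] → w' ≠ [] → w ≠ w' → ∀ i j,
    inner ℝ (wordOp T w (Sum.elim v u i)) (wordOp T w' (Sum.elim v u j)) = 0
  noise_input : ∀ σ i j, inner ℝ (T σ (v i)) (T σ (u j)) = 0
  state_noise : ∀ σ i j, inner ℝ (T σ (x i)) (T σ (Sum.elim v u j)) = 0
  past_state_noise : ∀ w : List (Fin d), w ≠ [] → ∀ i j,
    inner ℝ (wordOp T w (x i)) (Sum.elim v u j) = 0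
  mul_eq_zero : ∀ σ₁ σ₂, (σ₁, σ₂) ∉ E → S.A σ₂ * S.A σ₁ = 0
  mul_noise_eq_zero : ∀ σ₁ σ₂, (σ₁, σ₂) ∉ E → ∀ i k,
    inner ℝ (lc (S.A σ₂ * Matrix.fromCols (S.K σ₁) (S.B σ₁))
      (fun j => T σ₁ (Sum.elim v u j)) i) (T σ₁ (Sum.elim v u k)) = 0

theorem inner_sum_smul_apply_eq_zero {T : Fin d → V →L[ℝ] V} {E : Set (Fin d × Fin d)}
    {a : Fin d → ℝ} (hT : IsSwitchingFamily T E a) (c : Fin d → ℝ) (f : Fin d → V) (τ : Fin d)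
    (g : V) (h : inner ℝ (T τ (f τ)) (T τ g) = 0) :
    inner ℝ (∑ σ, c σ • T σ (f σ)) (T τ g) = 0 := by
  rw [sum_inner]
  refine Finset.sum_eq_zero fun σ _ => ?_
  rw [inner_smul_left]
  by_cases hστ : σ = τ
  · subst hστ; rw [h, mul_zero]
  · rw [hT.inner_of_ne _ _ _ _ hστ, mul_zero]

theorem fromCols_lc_apply (T : V →L[ℝ] V) {l m n : Type*} [Fintype m] [Fintype n]
    (M : Matrix l m ℝ) (N : Matrix l n ℝ) (x : m → V) (y : n → V) (i : l) :
    lc (Matrix.fromCols M N) (fun j => T (Sum.elim x y j)) i = T (lc M x i) + T (lc N y i) := by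
  rw [← map_lc, fromCols_lc, map_add]

/-- Both blocks of the noise condition of a system whose noise and input are uncorrelated. -/
theorem inner_mul_fromCols_eq_zero_iff {l : Type*} {T : V →L[ℝ] V} {v : Fin nn → V}
    {u : Fin nu → V} (h : ∀ i j, inner ℝ (T (v i)) (T (u j)) = 0)
    (A : Matrix l (Fin nx) ℝ) (K : Matrix (Fin nx) (Fin nn) ℝ) (B : Matrix (Fin nx) (Fin nu) ℝ)
    (i : l) :
    (∀ k, inner ℝ (lc (A * Matrix.fromCols K B) (fun j => T (Sum.elim v u j)) i)
      (T (Sum.elim v u k)) = 0) ↔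
    (∀ k, inner ℝ (T (lc A (lc K v) i)) (T (v k)) = 0) ∧
      ∀ k, inner ℝ (T (lc A (lc B u) i)) (T (u k)) = 0 := by
  have hK : ∀ k, inner ℝ (T (lc A (lc K v) i)) (T (u k)) = 0 := fun k => by
    rw [← mul_lc, map_lc]
    exact inner_lc_left_eq_zero _ (fun j => h j k) _
  have hB : ∀ k, inner ℝ (T (lc A (lc B u) i)) (T (v k)) = 0 := fun k => by
    rw [← mul_lc, map_lc]
    exact inner_lc_left_eq_zero _ (fun j => (real_inner_comm _ _).trans (h k j)) _
  rw [Matrix.mul_fromCols, fromCols_lc_apply, mul_lc, mul_lc, Sum.forall]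
  simp only [Sum.elim_inl, Sum.elim_inr, inner_add_left, hK, hB, zero_add, add_zero]

namespace IsRealization

variable {T : Fin d → V →L[ℝ] V} {E : Set (Fin d × Fin d)} {a c : Fin d → ℝ}
  {y : Fin ny → V} {u : Fin nu → V} {S : GLSS d nx nu nn ny} {x : Fin nx → V} {v : Fin nn → V}

/-- Whiteness compares nonempty words only. Applying one more letter to both vectors makes the words
nonempty and still different, and summing over that letter recovers the inner product. -/
theorem inner_noise_wordOp (hS : IsRealization T E c y u S x v) (hT : IsSwitchingFamily T E a)
    {w : List (Fin d)} (hw : w ≠ []) (i j : Fin nn ⊕ Fin nu) :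
    inner ℝ (Sum.elim v u i) (wordOp T w (Sum.elim v u j)) = 0 := by
  refine hT.inner_eq_zero_of_forall_apply fun σ => ?_
  rw [← wordOp_append_singleton, ← wordOp_singleton]
  refine hS.white _ _ (by simp) (by simp) ?_ i j
  simpa using hw

theorem inner_noise_input (hS : IsRealization T E c y u S x v) (hT : IsSwitchingFamily T E a)
    (w w' : List (Fin d)) (i : Fin nn) (j : Fin nu) :
    inner ℝ (wordOp T w (v i)) (wordOp T w' (u j)) = 0 :=
  hT.inner_wordOp_eq_zero (fun σ => hS.noise_input σ i j)
    (fun _ h => hS.inner_noise_wordOp hT h (.inl i) (.inr j))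
    (fun _ h => (real_inner_comm _ _).trans (hS.inner_noise_wordOp hT h (.inr j) (.inl i))) w w'

theorem inner_input_eq_zero (hS : IsRealization T E c y u S x v) (hT : IsSwitchingFamily T E a)
    (j : Fin nu) {f : V} (hf : f ∈ pastSpan T u) : inner ℝ (u j) f = 0 :=
  inner_eq_zero_of_mem_pastSpan (fun _ h i => hS.inner_noise_wordOp hT h (.inr j) (.inr i)) hf

theorem inner_apply_input_eq_zero (hS : IsRealization T E c y u S x v)
    (hT : IsSwitchingFamily T E a) (σ : Fin d)
    (j : Fin nu) {f : V} (hf : f ∈ pastSpan T u) : inner ℝ (T σ (u j)) (T σ f) = 0 :=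
  hT.inner_apply_eq_zero_of_mem_pastSpan
    (fun _ h i => hS.inner_noise_wordOp hT h (.inr j) (.inr i)) hf

theorem noise_condition (hS : IsRealization T E c y u S x v) {σ₁ σ₂ : Fin d}
    (h : (σ₁, σ₂) ∉ E) (i : Fin nx) :
    (∀ k, inner ℝ (T σ₁ (lc (S.A σ₂) (lc (S.K σ₁) v) i)) (T σ₁ (v k)) = 0) ∧
      ∀ k, inner ℝ (T σ₁ (lc (S.A σ₂) (lc (S.B σ₁) u) i)) (T σ₁ (u k)) = 0 :=
  (inner_mul_fromCols_eq_zero_iff (hS.noise_input σ₁) _ _ _ i).1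
    fun k => hS.mul_noise_eq_zero σ₁ σ₂ h i k

/-- The vector is a combination of the `T σ₁ (v k)` and is orthogonal to all of them, so its norm
vanishes. -/
theorem apply_noise_eq_zero (hS : IsRealization T E c y u S x v) {σ₁ σ₂ : Fin d}
    (h : (σ₁, σ₂) ∉ E) (i : Fin nx) : T σ₁ (lc (S.A σ₂) (lc (S.K σ₁) v) i) = 0 := by
  rw [← inner_self_eq_zero (𝕜 := ℝ)]
  nth_rw 1 [← mul_lc, map_lc]
  refine inner_lc_left_eq_zero _ (fun j => ?_) _
  rw [real_inner_comm]
  exact (hS.noise_condition h i).1 j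

/-- Decomposition of the state into a part driven by the input and a part that is uncorrelated
with the input. -/
theorem exists_state_decomposition [CompleteSpace V] (hS : IsRealization T E c y u S x v)
    (hT : IsSwitchingFamily T E a) :
    ∃ xd xs : Fin nx → V, (∀ i, x i = xd i + xs i) ∧ (∀ i, xd i ∈ pastSpan T u) ∧
      (∀ w w' i j, inner ℝ (wordOp T w (xs i)) (wordOp T w' (u j)) = 0) ∧
      (∀ i, xd i = ∑ σ, c σ • T σ (lc (S.A σ) xd i + lc (S.B σ) u i)) ∧
      (∀ i, xs i = ∑ σ, c σ • T σ (lc (S.A σ) xs i + lc (S.K σ) v i)) := by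
  have : CompleteSpace (pastSpan T u) :=
    (Submodule.isClosed_topologicalClosure _).completeSpace_coe
  let xd : Fin nx → V := fun i => (pastSpan T u).starProjection (x i)
  let xs : Fin nx → V := fun i => x i - xd i
  have hx : ∀ i, x i = xd i + xs i := fun i => by simp [xs]
  have hxd : ∀ i, xd i ∈ pastSpan T u := fun i => Submodule.starProjection_apply_mem _ _
  -- The projection removes the strict past of the input from `x`. Simultaneous and later input is
  -- already uncorrelated with `x` and with that past.
  have horth : ∀ w w' i j, inner ℝ (wordOp T w (xs i)) (wordOp T w' (u j)) = 0 := by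
    intro w w' i j
    refine hT.inner_wordOp_eq_zero (fun σ => ?_) (fun w hw => ?_) (fun w hw => ?_) w w'
    · rw [map_sub, inner_sub_left,
        show inner ℝ (T σ (x i)) (T σ (u j)) = 0 from hS.state_noise σ i (.inr j), real_inner_comm,
        hS.inner_apply_input_eq_zero hT σ j (hxd i), sub_zero]
    · exact Submodule.starProjection_inner_eq_zero _ _ (wordOp_mem_pastSpan hw j)
    · rw [map_sub, inner_sub_left,
        show inner ℝ (wordOp T w (x i)) (u j) = 0 from hS.past_state_noise w hw i (.inr j),
        real_inner_comm,
        hS.inner_input_eq_zero hT j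
          (wordOp_apply_mem_pastSpan hw (pastSpan_le_fullSpan (hxd i))), sub_zero]
  have hsplit : ∀ i, x i = ∑ σ, c σ • T σ (lc (S.A σ) xd i + lc (S.B σ) u i) +
      ∑ σ, c σ • T σ (lc (S.A σ) xs i + lc (S.K σ) v i) := fun i => by
    rw [← Finset.sum_add_distrib]
    refine (hS.state_eq i).trans (Finset.sum_congr rfl fun σ _ => ?_)
    rw [← smul_add, ← map_add]
    congr 2
    rw [show x = fun i => xd i + xs i from funext hx, lc_add]
    abel
  -- Uniqueness of projections: the right side lies in the past of `u`, and by `hsplit` it differs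
  -- from `x` by terms in `xs` and `v`, orthogonal to all input words. Subtraction then yields the
  -- recursion of `xs`.
  have hxd_eq : ∀ i, xd i = ∑ σ, c σ • T σ (lc (S.A σ) xd i + lc (S.B σ) u i) := by
    intro i
    refine Submodule.eq_starProjection_of_mem_of_inner_eq_zero ?_ ?_
    · refine Submodule.sum_mem _ fun σ _ => Submodule.smul_mem _ _ (apply_mem_pastSpan σ ?_)
      exact Submodule.add_mem _ (lc_mem _ (fun j => pastSpan_le_fullSpan (hxd j)) _)
        (lc_mem _ mem_fullSpan _)
    · intro g hg
      refine inner_eq_zero_of_mem_pastSpan (fun w hw j => ?_) hg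
      nth_rw 1 [hsplit i]
      rw [add_sub_cancel_left]
      obtain rfl | ⟨w, τ, rfl⟩ := List.eq_nil_or_concat' w
      · exact absurd rfl hw
      rw [wordOp_append_singleton]
      refine inner_sum_smul_apply_eq_zero hT c _ τ _ ?_
      rw [← wordOp_append_singleton, map_add, inner_add_left, map_lc, map_lc,
        inner_lc_left_eq_zero _ (x := fun k => T τ (xs k)) (fun k => horth [τ] (w ++ [τ]) k j),
        inner_lc_left_eq_zero _ (x := fun k => T τ (v k))
          (fun k => hS.inner_noise_input hT [τ] (w ++ [τ]) k j), add_zero]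
  refine ⟨xd, xs, hx, hxd, horth, hxd_eq, fun i => ?_⟩
  have := hsplit i
  rw [← hxd_eq, hx i] at this
  exact add_left_cancel this

/-- Existence of the innovation form. -/
theorem exists_innovation [CompleteSpace V] (hS : IsRealization T E c y u S x v)
    (hT : IsSwitchingFamily T E a) {yd ys yp : Fin ny → V}
    (hyd_mem : ∀ i, yd i ∈ fullSpan T u)
    (hyd : ∀ i, ∀ g ∈ fullSpan T u, inner ℝ (y i - yd i) g = 0)
    (hys : ∀ i, ys i = y i - yd i)
    (hyp_mem : ∀ i, yp i ∈ pastSpan T ys)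
    (hyp : ∀ i, ∀ g ∈ pastSpan T ys, inner ℝ (ys i - yp i) g = 0) :
    ∃ (K : Fin d → Matrix (Fin nx) (Fin ny) ℝ) (x' : Fin nx → V),
      IsRealization T E c y u ⟨S.A, S.B, K, S.C, S.D, 1⟩ x' (fun i => ys i - yp i) := by
  obtain ⟨xd, xs, hx, hxd, hxs, hxd_eq, hxs_eq⟩ := hS.exists_state_decomposition hT
  have hcU : CompleteSpace (fullSpan T u) :=
    (Submodule.isClosed_topologicalClosure _).completeSpace_coe
  have hcY : CompleteSpace (pastSpan T ys) :=
    (Submodule.isClosed_topologicalClosure _).completeSpace_coe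
  have hyd_eq : ∀ i, yd i = lc S.C xd i + lc S.D u i := by
    intro i
    rw [← Submodule.eq_starProjection_of_mem_of_inner_eq_zero (hyd_mem i) (hyd i)]
    refine Submodule.eq_starProjection_of_mem_of_inner_eq_zero ?_ fun g hg => ?_
    · exact Submodule.add_mem _ (lc_mem _ (fun j => pastSpan_le_fullSpan (hxd j)) _)
        (lc_mem _ mem_fullSpan _)
    · refine inner_eq_zero_of_mem_fullSpan (fun w j => ?_) hg
      have : y i - (lc S.C xd i + lc S.D u i) = lc S.C xs i + lc S.F v i := by
        rw [hS.output_eq, show x = fun i => xd i + xs i from funext hx, lc_add]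
        abel
      rw [this, inner_add_left, inner_lc_left_eq_zero _ (x := xs) (fun k => hxs [] w k j),
        inner_lc_left_eq_zero _ (x := v) (fun k => hS.inner_noise_input hT [] w k j), add_zero]
  have hys_eq : ∀ i, ys i = lc S.C xs i + lc S.F v i := by
    intro i
    rw [hys, hyd_eq, hS.output_eq, show x = fun i => xd i + xs i from funext hx, lc_add]
    abel
  have hYU : ∀ {f g : V}, f ∈ fullSpan T ys → g ∈ fullSpan T u → inner ℝ f g = 0 := by
    intro f g hf hg
    refine inner_fullSpan_fullSpan_eq_zero (fun w w' i j => ?_) hf hg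
    rw [hys_eq, map_add, inner_add_left, map_lc, map_lc,
      inner_lc_left_eq_zero _ (fun k => hxs w w' k j),
      inner_lc_left_eq_zero _ (fun k => hS.inner_noise_input hT w w' k j), add_zero]
  -- Noise is orthogonal to the past of the full state, and to `xd` because `xd` is built from the
  -- input; hence to the past of `xs` and of `y^s`.
  have hvY : ∀ k, ∀ w : List (Fin d), w ≠ [] → ∀ i, inner ℝ (v k) (wordOp T w (ys i)) = 0 := by
    intro k w hw i
    rw [real_inner_comm, hys_eq, map_add, inner_add_left, map_lc, map_lc,
      inner_lc_left_eq_zero _ (fun j => ?_), inner_lc_left_eq_zero _ (fun j => ?_), add_zero]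
    · rw [real_inner_comm]
      exact hS.inner_noise_wordOp hT hw (.inl k) (.inl j)
    · have h1 : inner ℝ (wordOp T w (x j)) (v k) = 0 := hS.past_state_noise w hw j (.inl k)
      have h2 : inner ℝ (v k) (wordOp T w (xd j)) = 0 :=
        inner_eq_zero_of_mem_fullSpan (fun w' l => hS.inner_noise_input hT [] w' k l)
          (wordOp_apply_mem_fullSpan w (pastSpan_le_fullSpan (hxd j)))
      rw [real_inner_comm] at h2
      rw [hx, map_add, inner_add_left, h2, zero_add] at h1
      exact h1
  let xh : Fin nx → V := fun i => (pastSpan T ys).starProjection (xs i)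
  have hxh : ∀ i, xh i ∈ pastSpan T ys := fun i => Submodule.starProjection_apply_mem _ _
  have hxsh : ∀ i, ∀ g ∈ pastSpan T ys, inner ℝ (xs i - xh i) g = 0 := fun i g hg =>
    Submodule.starProjection_inner_eq_zero _ _ hg
  have hyp_eq : ∀ i, yp i = lc S.C xh i := by
    intro i
    rw [← Submodule.eq_starProjection_of_mem_of_inner_eq_zero (hyp_mem i) (hyp i)]
    refine Submodule.eq_starProjection_of_mem_of_inner_eq_zero (lc_mem _ hxh _) fun g hg => ?_
    have : ys i - lc S.C xh i = lc S.C (fun j => xs j - xh j) i + lc S.F v i := by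
      rw [hys_eq, lc_sub]
      abel
    rw [this, inner_add_left, inner_lc_left_eq_zero _ (fun k => hxsh k g hg),
      inner_lc_left_eq_zero _ (fun k => inner_eq_zero_of_mem_pastSpan (hvY k) hg), add_zero]
  let e : Fin ny → V := fun i => ys i - yp i
  have he_mem : ∀ i, e i ∈ fullSpan T ys := fun i =>
    Submodule.sub_mem _ (mem_fullSpan i) (pastSpan_le_fullSpan (hyp_mem i))
  have he : ∀ i, ∀ g ∈ pastSpan T ys, inner ℝ (e i) g = 0 := hyp
  have he_apply : ∀ σ i, ∀ g ∈ pastSpan T ys, inner ℝ (T σ (e i)) (T σ g) = 0 := fun σ i g hg =>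
    hT.inner_apply_eq_zero_of_mem_pastSpan (fun w hw j => he i _ (wordOp_mem_pastSpan hw j)) hg
  -- The filter gain: for each letter, project the driven term onto the finite span of the `T σ (e
  -- k)`.
  obtain ⟨K, hK⟩ : ∃ K : Fin d → Matrix (Fin nx) (Fin ny) ℝ, ∀ σ i k,
      inner ℝ (T σ (lc (S.A σ) xs i + lc (S.K σ) v i - lc (K σ) e i)) (T σ (e k)) = 0 := by
    choose K hK using fun σ i => exists_lc_inner_eq_zero
      (T σ (lc (S.A σ) xs i + lc (S.K σ) v i)) (fun k => T σ (e k))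
    refine ⟨fun σ => Matrix.of (K σ), fun σ i k => ?_⟩
    rw [map_sub, map_lc (T σ) (Matrix.of (K σ))]
    exact hK σ i k
  have hxh_eq : ∀ i, xh i = ∑ σ, c σ • T σ (lc (S.A σ) xh i + lc (K σ) e i) := by
    intro i
    refine Submodule.eq_starProjection_of_mem_of_inner_eq_zero ?_ ?_
    · refine Submodule.sum_mem _ fun σ _ => Submodule.smul_mem _ _ (apply_mem_pastSpan σ ?_)
      exact Submodule.add_mem _ (lc_mem _ (fun j => pastSpan_le_fullSpan (hxh j)) _)
        (lc_mem _ he_mem _)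
    intro g hg
    refine inner_eq_zero_of_mem_pastSpan (fun w hw j => ?_) hg
    -- The one-step prediction error of the filter before `T σ` is applied. All three of its terms
    -- are orthogonal to the strict past of `ys` (`hmY`).
    let m : Fin d → V := fun σ =>
      lc (S.A σ) (fun j => xs j - xh j) i + lc (S.K σ) v i - lc (K σ) e i
    have hm : xs i - ∑ σ, c σ • T σ (lc (S.A σ) xh i + lc (K σ) e i) =
        ∑ σ, c σ • T σ (m σ) := by
      nth_rw 1 [hxs_eq i]
      rw [← Finset.sum_sub_distrib]
      refine Finset.sum_congr rfl fun σ _ => ?_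
      rw [← smul_sub, ← map_sub]
      congr 2
      simp only [m, lc_sub]
      abel
    have hmY : ∀ σ, ∀ w : List (Fin d), w ≠ [] → ∀ k, inner ℝ (m σ) (wordOp T w (ys k)) = 0 := by
      intro σ w hw k
      rw [inner_sub_left, inner_add_left,
        inner_lc_left_eq_zero _ (fun l => hxsh l _ (wordOp_mem_pastSpan hw k)),
        inner_lc_left_eq_zero _ (fun l => hvY l w hw k),
        inner_lc_left_eq_zero _ (fun l => he l _ (wordOp_mem_pastSpan hw k)), add_zero, sub_zero]
    rw [hm]
    obtain rfl | ⟨w, τ, rfl⟩ := List.eq_nil_or_concat' w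
    · exact absurd rfl hw
    rw [wordOp_append_singleton]
    refine inner_sum_smul_apply_eq_zero hT c m τ _ ?_
    -- For longer words `hmY` survives `T τ`. For the single letter `τ`, `ys` splits into `yp`,
    -- which lies in the past, and `e`, against which the choice of gain does the work.
    rcases eq_or_ne w [] with rfl | hw'
    · have hysj : ys j = e j + yp j := by simp [e]
      rw [wordOp_nil, hysj, map_add, inner_add_right,
        hT.inner_apply_eq_zero_of_mem_pastSpan (hmY τ) (hyp_mem j), add_zero]
      have hmτ : m τ = (lc (S.A τ) xs i + lc (S.K τ) v i - lc (K τ) e i) - lc (S.A τ) xh i := by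
        simp only [m, lc_sub]
        abel
      rw [hmτ, map_sub, inner_sub_left, hK, zero_sub, neg_eq_zero, real_inner_comm]
      exact he_apply τ j _ (lc_mem _ hxh _)
    · exact hT.inner_apply_eq_zero_of_mem_pastSpan (hmY τ) (wordOp_mem_pastSpan hw' j)
  have hne : ∀ {f g : V}, f ∈ fullSpan T u → g ∈ fullSpan T ys → inner ℝ f g = 0 :=
    fun hf hg => (real_inner_comm _ _).trans (hYU hg hf)
  have hTfull : ∀ {ι : Type} {R : ι → V} (σ : Fin d) {f : V}, f ∈ fullSpan T R →
      T σ f ∈ fullSpan T R := fun σ _ hf => pastSpan_le_fullSpan (apply_mem_pastSpan σ hf)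
  have hnoise : ∀ σ i j, inner ℝ (T σ (e i)) (T σ (u j)) = 0 := fun σ i j =>
    hYU (hTfull σ (he_mem i)) (hTfull σ (mem_fullSpan j))
  refine ⟨K, fun i => xd i + xh i, ⟨fun i => ?_, fun i => ?_, ?_, hnoise, ?_, ?_,
    hS.mul_eq_zero, ?_⟩⟩
  · dsimp only
    nth_rw 1 [hxd_eq, hxh_eq]
    rw [← Finset.sum_add_distrib]
    refine Finset.sum_congr rfl fun σ _ => ?_
    rw [← smul_add, ← map_add]
    congr 2
    rw [lc_add]
    abel
  · have : y i = yd i + yp i + e i := by simp [e, hys]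
    rw [this, hyd_eq, hyp_eq]
    change _ = lc S.C (fun i => xd i + xh i) i + lc S.D u i + lc 1 e i
    rw [lc_add, one_lc]
    abel
  · intro w w' hw hw' hww
    rintro (i | i) (j | j)
    · refine hT.inner_wordOp_eq_zero_of_ne (fun w hw => ?_) (fun w hw => ?_) hww
      · exact he i _ (wordOp_apply_mem_pastSpan hw (he_mem j))
      · rw [real_inner_comm]
        exact he j _ (wordOp_apply_mem_pastSpan hw (he_mem i))
    · exact hYU (wordOp_apply_mem_fullSpan w (he_mem i)) (wordOp_mem_fullSpan w' j)
    · exact hne (wordOp_mem_fullSpan w i) (wordOp_apply_mem_fullSpan w' (he_mem j))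
    · exact hS.white w w' hw hw' hww (.inr i) (.inr j)
  · rintro σ i (j | j)
    · change inner ℝ (T σ (xd i + xh i)) (T σ (e j)) = 0
      rw [map_add, inner_add_left,
        hne (hTfull σ (pastSpan_le_fullSpan (hxd i))) (hTfull σ (he_mem j)), zero_add,
        real_inner_comm]
      exact he_apply σ j _ (hxh i)
    · change inner ℝ (T σ (xd i + xh i)) (T σ (u j)) = 0
      rw [map_add, inner_add_left,
        hYU (hTfull σ (pastSpan_le_fullSpan (hxh i))) (hTfull σ (mem_fullSpan j)), add_zero,
        real_inner_comm]
      exact hS.inner_apply_input_eq_zero hT σ j (hxd i)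
  · rintro w hw i (j | j)
    · change inner ℝ (wordOp T w (xd i + xh i)) (e j) = 0
      rw [map_add, inner_add_left,
        hne (wordOp_apply_mem_fullSpan w (pastSpan_le_fullSpan (hxd i))) (he_mem j), zero_add,
        real_inner_comm]
      exact he j _ (wordOp_apply_mem_pastSpan hw (pastSpan_le_fullSpan (hxh i)))
    · change inner ℝ (wordOp T w (xd i + xh i)) (u j) = 0
      rw [map_add, inner_add_left,
        hYU (wordOp_apply_mem_fullSpan w (pastSpan_le_fullSpan (hxh i))) (mem_fullSpan j),
        add_zero, real_inner_comm]
      exact hS.inner_input_eq_zero hT j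
        (wordOp_apply_mem_pastSpan hw (pastSpan_le_fullSpan (hxd i)))
  · intro σ₁ σ₂ h i
    refine (inner_mul_fromCols_eq_zero_iff (hnoise σ₁) _ _ _ i).2
      ⟨fun k => ?_, (hS.noise_condition h i).2⟩
    -- Since `A σ₂ * A σ₁ = 0`, the new noise term is, up to the vanishing old noise term, minus `A
    -- σ₂` applied to the residual of the gain projection, which is orthogonal to every `T σ₁ (e
    -- k)`.
    have h1 : lc (S.A σ₂) (lc (K σ₁) e) i = lc (S.A σ₂) (lc (S.K σ₁) v) i -
        lc (S.A σ₂) (fun l => lc (S.A σ₁) xs l + lc (S.K σ₁) v l - lc (K σ₁) e l) i := by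
      rw [lc_sub, lc_add]
      rw [← mul_lc (S.A σ₂) (S.A σ₁), hS.mul_eq_zero _ _ h, zero_lc]
      abel
    change inner ℝ (T σ₁ (lc (S.A σ₂) (lc (K σ₁) e) i)) (T σ₁ (e k)) = 0
    rw [h1, map_sub, hS.apply_noise_eq_zero h, zero_sub, inner_neg_left, neg_eq_zero, map_lc]
    exact inner_lc_left_eq_zero _ (fun l => hK σ₁ l k) _

end IsRealization

end Realization

/-! ### Conditional independence through conditional expectations -/

section CondIndep

variable {Ω : Type*} {m m₁ m₂ G : MeasurableSpace Ω}

theorem sup_eq_generateFrom_inter (m m₁ : MeasurableSpace Ω) :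
    m ⊔ m₁ = MeasurableSpace.generateFrom
      {s | ∃ a b, MeasurableSet[m] a ∧ MeasurableSet[m₁] b ∧ s = a ∩ b} := by
  refine le_antisymm (sup_le ?_ ?_) (MeasurableSpace.generateFrom_le ?_)
  · exact fun a ha => MeasurableSpace.measurableSet_generateFrom
      ⟨a, Set.univ, ha, MeasurableSet.univ, (Set.inter_univ a).symm⟩
  · exact fun b hb => MeasurableSpace.measurableSet_generateFrom
      ⟨Set.univ, b, MeasurableSet.univ, hb, (Set.univ_inter b).symm⟩
  · rintro _ ⟨a, b, ha, hb, rfl⟩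
    exact MeasurableSet.inter (le_sup_left (a := m) _ ha) (le_sup_right (a := m) _ hb)

variable [m0 : MeasurableSpace Ω] {P : Measure Ω} [IsProbabilityMeasure P]

theorem integrable_indicator_one {s : Set Ω} (hs : MeasurableSet s) :
    Integrable (s.indicator fun _ => (1 : ℝ)) P :=
  (integrable_const 1).indicator hs

/-- On intersections `a ∩ b` the defining integral identity is the product formula of conditional
independence; these sets form a π-system generating `m ⊔ m₁`, and a π-λ argument does the rest. -/
theorem CondIndepGiven.condExp_indicator_sup (h : CondIndepGiven P m m₁ m₂) (hm : m ≤ m0)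
    (hm₁ : m₁ ≤ m0) (hm₂ : m₂ ≤ m0) {s : Set Ω} (hs : MeasurableSet[m₂] s) :
    P[s.indicator (fun _ => (1 : ℝ)) | m ⊔ m₁] =ᵐ[P] P[s.indicator (fun _ => (1 : ℝ)) | m] := by
  have hs0 : MeasurableSet s := hm₂ s hs
  have hsup : m ⊔ m₁ ≤ m0 := sup_le hm hm₁
  have hmeas : StronglyMeasurable[m ⊔ m₁] (P[s.indicator (fun _ => (1 : ℝ)) | m]) :=
    (stronglyMeasurable_condExp (m := m)).mono (le_sup_left : m ≤ m ⊔ m₁)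
  refine (ae_eq_condExp_of_forall_setIntegral_eq hsup (integrable_indicator_one hs0)
    (fun _ _ _ => integrable_condExp.integrableOn) (fun t ht _ => ?_)
    hmeas.aestronglyMeasurable).symm
  induction t, ht using MeasurableSpace.induction_on_inter (sup_eq_generateFrom_inter m m₁) with
  | h_inter =>
    rintro _ ⟨a, b, ha, hb, rfl⟩ _ ⟨a', b', ha', hb', rfl⟩ -
    exact ⟨a ∩ a', b ∩ b', ha.inter ha', hb.inter hb', Set.inter_inter_inter_comm _ _ _ _⟩
  | empty => simp
  | basic t ht =>
    obtain ⟨a, b, ha, hb, rfl⟩ := ht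
    have hb0 := hm₁ b hb
    have h1 : ∀ f : Ω → ℝ, ∫ ω in a ∩ b, f ω ∂P = ∫ ω in a, b.indicator (fun _ => (1 : ℝ)) ω * f ω ∂P := by
      intro f
      rw [← setIntegral_indicator hb0]
      refine integral_congr_ae (.of_forall fun ω => ?_)
      by_cases hω : ω ∈ b <;> simp [hω]
    have hint : Integrable (b.indicator (fun _ => (1 : ℝ)) *
        P[s.indicator (fun _ => (1 : ℝ)) | m]) P := by
      have : b.indicator (fun _ => (1 : ℝ)) * P[s.indicator (fun _ => (1 : ℝ)) | m] =
          b.indicator (P[s.indicator (fun _ => (1 : ℝ)) | m]) := by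
        ext ω
        by_cases hω : ω ∈ b <;> simp [hω]
      rw [this]
      exact integrable_condExp.indicator hb0
    have h2 : P[b.indicator (fun _ => (1 : ℝ)) * P[s.indicator (fun _ => (1 : ℝ)) | m] | m] =ᵐ[P]
        P[(b ∩ s).indicator (fun _ => (1 : ℝ)) | m] :=
      (condExp_mul_of_stronglyMeasurable_right stronglyMeasurable_condExp hint
        (integrable_indicator_one hb0)).trans (h b s hb hs).symm
    rw [h1, h1]
    calc ∫ ω in a, b.indicator (fun _ => (1 : ℝ)) ω * P[s.indicator (fun _ => (1 : ℝ)) | m] ω ∂P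
        = ∫ ω in a, P[b.indicator (fun _ => (1 : ℝ)) *
            P[s.indicator (fun _ => (1 : ℝ)) | m] | m] ω ∂P :=
          (setIntegral_condExp hm hint ha).symm
      _ = ∫ ω in a, P[(b ∩ s).indicator (fun _ => (1 : ℝ)) | m] ω ∂P :=
          integral_congr_ae (ae_restrict_of_ae h2)
      _ = ∫ ω in a, (b ∩ s).indicator (fun _ => (1 : ℝ)) ω ∂P :=
          setIntegral_condExp hm (integrable_indicator_one (hb0.inter hs0)) ha
      _ = _ := by
          refine integral_congr_ae (.of_forall fun ω => ?_)
          by_cases hω : ω ∈ b <;> by_cases hω' : ω ∈ s <;> simp [hω, hω']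
  | compl t ht ih =>
    have ht0 := hsup t ht
    rw [setIntegral_compl ht0 integrable_condExp,
      setIntegral_compl ht0 (integrable_indicator_one hs0), ih (measure_lt_top _ _),
      integral_condExp hm]
  | iUnion f hd hf ih =>
    rw [integral_iUnion (fun i => hsup _ (hf i)) hd integrable_condExp.integrableOn,
      integral_iUnion (fun i => hsup _ (hf i)) hd (integrable_indicator_one hs0).integrableOn]
    exact tsum_congr fun i => ih i (measure_lt_top _ _)

theorem CondIndepGiven.condExp_sup (h : CondIndepGiven P m m₁ m₂) (hm : m ≤ m0)
    (hm₁ : m₁ ≤ m0) (hm₂ : m₂ ≤ m0) {f : Ω → ℝ} (hf : Integrable f P)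
    (hfm : AEStronglyMeasurable[m₂] f P) : P[f | m ⊔ m₁] =ᵐ[P] P[f | m] := by
  refine MemLp.induction_stronglyMeasurable hm₂ ENNReal.one_ne_top
    (fun f => P[f | m ⊔ m₁] =ᵐ[P] P[f | m]) ?_ ?_ ?_ ?_ (memLp_one_iff_integrable.2 hf) hfm
  · intro c s hs _
    have : (s.indicator fun _ => c) = c • s.indicator fun _ => (1 : ℝ) := by
      ext ω
      by_cases hω : ω ∈ s <;> simp [hω]
    rw [this]
    exact (condExp_smul c _ _).trans (((h.condExp_indicator_sup hm hm₁ hm₂ hs).const_smul c).trans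
      (condExp_smul c _ _).symm)
  · intro f g _ hf hg _ _ hf' hg'
    rw [memLp_one_iff_integrable] at hf hg
    exact (condExp_add hf hg _).trans ((hf'.add hg').trans (condExp_add hf hg _).symm)
  · have hsup : m ⊔ m₁ ≤ m0 := sup_le hm hm₁
    have hset : {f : lpMeas ℝ ℝ m₂ 1 P | P[(f : Ω → ℝ) | m ⊔ m₁] =ᵐ[P] P[(f : Ω → ℝ) | m]} =
        {f : lpMeas ℝ ℝ m₂ 1 P | condExpL1CLM ℝ hsup P (f : Lp ℝ 1 P) =
          condExpL1CLM ℝ hm P (f : Lp ℝ 1 P)} := by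
      ext f
      have h1 := condExp_ae_eq_condExpL1CLM hsup (L1.integrable_coeFn (f : Lp ℝ 1 P))
      have h2 := condExp_ae_eq_condExpL1CLM hm (L1.integrable_coeFn (f : Lp ℝ 1 P))
      rw [Integrable.toL1_coeFn] at h1 h2
      simp only [Set.mem_ofPred_eq]
      exact ⟨fun hf => Lp.ext (h1.symm.trans (hf.trans h2)), fun hf =>
        h1.trans ((Filter.EventuallyEq.of_eq (by rw [hf])).trans h2.symm)⟩
    rw [hset]
    exact isClosed_eq
      ((condExpL1CLM ℝ hsup P).continuous.comp continuous_subtype_val)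
      ((condExpL1CLM ℝ hm P).continuous.comp continuous_subtype_val)
  · intro f g hfg _ hf
    exact (condExp_congr_ae hfg.symm).trans (hf.trans (condExp_congr_ae hfg))

/-- A converse in which `m₁` is contained in `G` only up to null sets. This is needed for the new
state and innovation, which are merely almost surely equal to functions of the history. The proof
pulls out the `m₁` indicator given `G` and then conditions on `m`. -/
theorem condIndepGiven_of_condExp_eq (hmG : m ≤ G) (hG : G ≤ m0)
    (hm₁ : m₁ ≤ m0) (hm₂ : m₂ ≤ m0)
    (hm₁G : m₁ ≤ eventuallyMeasurableSpace G (ae P))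
    (h : ∀ s, MeasurableSet[m₂] s →
      P[s.indicator (fun _ => (1 : ℝ)) | G] =ᵐ[P] P[s.indicator (fun _ => (1 : ℝ)) | m]) :
    CondIndepGiven P m m₁ m₂ := by
  intro s t hs ht
  have hs0 := hm₁ s hs
  have ht0 := hm₂ t ht
  obtain ⟨s', hs', hss'⟩ := hm₁G s hs
  have hsm : AEStronglyMeasurable[G] (s.indicator fun _ => (1 : ℝ)) P :=
    ⟨s'.indicator fun _ => (1 : ℝ), stronglyMeasurable_const.indicator hs',
      indicator_ae_eq_of_ae_eq_set hss'⟩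
  have hst : (s ∩ t).indicator (fun _ => (1 : ℝ)) =
      s.indicator (fun _ => (1 : ℝ)) * t.indicator (fun _ => (1 : ℝ)) := by
    ext ω
    by_cases hω : ω ∈ s <;> by_cases hω' : ω ∈ t <;> simp [hω, hω']
  have hint : Integrable (s.indicator (fun _ => (1 : ℝ)) * t.indicator (fun _ => (1 : ℝ))) P := by
    rw [← hst]
    exact integrable_indicator_one (hs0.inter ht0)
  have h1 : P[s.indicator (fun _ => (1 : ℝ)) * t.indicator (fun _ => (1 : ℝ)) | G] =ᵐ[P]
      s.indicator (fun _ => (1 : ℝ)) * P[t.indicator (fun _ => (1 : ℝ)) | m] :=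
    (condExp_mul_of_aestronglyMeasurable_left hsm hint (integrable_indicator_one ht0)).trans
      ((Filter.EventuallyEq.refl _ _).mul (h t ht))
  rw [hst]
  calc P[s.indicator (fun _ => (1 : ℝ)) * t.indicator (fun _ => (1 : ℝ)) | m]
      =ᵐ[P] P[P[s.indicator (fun _ => (1 : ℝ)) * t.indicator (fun _ => (1 : ℝ)) | G] | m] :=
        (condExp_condExp_of_le hmG hG).symm
    _ =ᵐ[P] P[s.indicator (fun _ => (1 : ℝ)) * P[t.indicator (fun _ => (1 : ℝ)) | m] | m] :=
        condExp_congr_ae h1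
    _ =ᵐ[P] _ := condExp_mul_of_stronglyMeasurable_right stronglyMeasurable_condExp
        (integrable_condExp.congr h1) (integrable_indicator_one hs0)

end CondIndep

/-! ### Multiplication under a bounded conditional second moment -/

section Multiplication

variable {Ω : Type*} {G : MeasurableSpace Ω} [m0 : MeasurableSpace Ω] {P : Measure Ω}
  [IsProbabilityMeasure P]

/-- The measures with densities `h` and `P[h | G]` agree on `G`, so no integrability of `φ` is
needed. That matters because square integrability of the product is what is to be proved. -/
theorem lintegral_mul_ofReal_condExp (hG : G ≤ m0) {h : Ω → ℝ} (hh : Integrable h P)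
    (h0 : 0 ≤ h) {φ : Ω → ENNReal} (hφ : Measurable[G] φ) :
    ∫⁻ ω, φ ω * ENNReal.ofReal (h ω) ∂P = ∫⁻ ω, φ ω * ENNReal.ofReal (P[h | G] ω) ∂P := by
  have hc0 : 0 ≤ᵐ[P] P[h | G] := condExp_nonneg (.of_forall h0)
  have hhm : AEMeasurable (fun ω => ENNReal.ofReal (h ω)) P := hh.aemeasurable.ennreal_ofReal
  have hcm : AEMeasurable (fun ω => ENNReal.ofReal (P[h | G] ω)) P :=
    integrable_condExp.aemeasurable.ennreal_ofReal
  have htrim : (P.withDensity fun ω => ENNReal.ofReal (h ω)).trim hG =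
      (P.withDensity fun ω => ENNReal.ofReal (P[h | G] ω)).trim hG := by
    refine @Measure.ext _ G _ _ fun s hs => ?_
    rw [trim_measurableSet_eq hG hs, trim_measurableSet_eq hG hs, withDensity_apply _ (hG s hs),
      withDensity_apply _ (hG s hs),
      ← ofReal_integral_eq_lintegral_ofReal hh.integrableOn (.of_forall h0),
      ← ofReal_integral_eq_lintegral_ofReal integrable_condExp.integrableOn
        (ae_restrict_of_ae hc0), setIntegral_condExp hG hh hs]
  have hφ0 : AEMeasurable φ P := (hφ.mono hG le_rfl).aemeasurable
  calc ∫⁻ ω, φ ω * ENNReal.ofReal (h ω) ∂P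
      = ∫⁻ ω, φ ω ∂(P.withDensity fun ω => ENNReal.ofReal (h ω)) := by
        rw [lintegral_withDensity_eq_lintegral_mul₀ hhm hφ0]
        simp only [Pi.mul_apply, mul_comm]
    _ = ∫⁻ ω, φ ω ∂(P.withDensity fun ω => ENNReal.ofReal (P[h | G] ω)) := by
        rw [← lintegral_trim hG hφ, htrim, lintegral_trim hG hφ]
    _ = _ := by
        rw [lintegral_withDensity_eq_lintegral_mul₀ hcm hφ0]
        simp only [Pi.mul_apply, mul_comm]

/-- A square integrable `G`-measurable function stays square integrable after multiplication by a
function whose conditional second moment given `G` is bounded. -/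
theorem memLp_mul_of_condExp_sq_le (hG : G ≤ m0) {f g : Ω → ℝ} (hf : MemLp f 2 P)
    (hfm : AEStronglyMeasurable[G] f P) (hg : MemLp g 2 P) {C : ℝ}
    (hC : ∀ᵐ ω ∂P, P[fun ω => g ω * g ω | G] ω ≤ C) : MemLp (fun ω => f ω * g ω) 2 P := by
  have hgg : Integrable (fun ω => g ω * g ω) P := hg.integrable_mul hg
  let f' := hfm.mk f
  have hf' : f =ᵐ[P] f' := hfm.ae_eq_mk
  have hf'm : StronglyMeasurable[G] f' := hfm.stronglyMeasurable_mk
  have hf'2 : MemLp f' 2 P := (memLp_congr_ae hf').1 hf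
  refine (memLp_congr_ae (hf'.mul (Filter.EventuallyEq.refl _ g))).2 ?_
  refine ⟨hf'2.1.mul hg.1, ?_⟩
  rw [eLpNorm_lt_top_iff_lintegral_rpow_enorm_lt_top two_ne_zero ENNReal.ofNat_ne_top]
  have hφ : Measurable[G] fun ω => ‖f' ω‖ₑ ^ (2 : ℝ) :=
    (hf'm.enorm).pow_const 2
  have hfin := (eLpNorm_lt_top_iff_lintegral_rpow_enorm_lt_top two_ne_zero
    ENNReal.ofNat_ne_top).1 hf'2.2
  simp only [ENNReal.toReal_ofNat] at hfin ⊢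
  calc ∫⁻ ω, ‖(f' * g) ω‖ₑ ^ (2 : ℝ) ∂P
      = ∫⁻ ω, ‖f' ω‖ₑ ^ (2 : ℝ) * ENNReal.ofReal (g ω * g ω) ∂P := by
        refine lintegral_congr fun ω => ?_
        rw [Pi.mul_apply, enorm_mul, ENNReal.mul_rpow_of_nonneg _ _ zero_le_two]
        congr 1
        rw [← Real.enorm_of_nonneg (mul_self_nonneg _), enorm_mul, ENNReal.rpow_two, sq]
    _ = ∫⁻ ω, ‖f' ω‖ₑ ^ (2 : ℝ) * ENNReal.ofReal (P[fun ω => g ω * g ω | G] ω) ∂P :=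
        lintegral_mul_ofReal_condExp hG hgg (fun ω => mul_self_nonneg _) hφ
    _ ≤ ∫⁻ ω, ‖f' ω‖ₑ ^ (2 : ℝ) * ENNReal.ofReal C ∂P := by
        refine lintegral_mono_ae (hC.mono fun ω hω => ?_)
        gcongr
    _ = (∫⁻ ω, ‖f' ω‖ₑ ^ (2 : ℝ) ∂P) * ENNReal.ofReal C :=
        lintegral_mul_const _ (hφ.mono hG le_rfl)
    _ < ⊤ := ENNReal.mul_lt_top hfin ENNReal.ofReal_lt_top

end Multiplication

/-! ### One Hilbert space for a stationary family -/

section StationarySpace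

variable {H : Type*} [NormedAddCommGroup H] [InnerProductSpace ℝ H] [CompleteSpace H]

/-- A jointly stationary family of processes in a Hilbert space `H` comes from vectors of one
Hilbert space `V`, read off at time `t` by an isometry `Φ t`. Operators on `H` that permute the
family while advancing the time induce operators on `V`. -/
theorem exists_stationary_space {κ ι : Type*} (z : κ → ℤ → H)
    (hz : ∀ k l t s h, inner ℝ (z k (t + h)) (z l (s + h)) = inner ℝ (z k t) (z l s))
    (M : ι → ℤ → H →L[ℝ] H) (θ : ι → κ → κ) (hM : ∀ σ k t, M σ t (z k t) = z (θ σ k) (t + 1)) :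
    ∃ (V : Submodule ℝ H) (Φ : ℤ → V →ₗᵢ[ℝ] H) (T : ι → V →L[ℝ] V) (Z : κ → V),
      CompleteSpace V ∧ (∀ k t, Φ t (Z k) = z k t) ∧
      (∀ σ t a, Φ (t + 1) (T σ a) = M σ t (Φ t a)) ∧
      (∀ a b t s h, inner ℝ (Φ (t + h) a) (Φ (s + h) b) = inner ℝ (Φ t a) (Φ s b)) ∧
      ∀ t a, Φ t a ∈ (Submodule.span ℝ (Set.range fun k => z k t)).topologicalClosure := by
  let L : ℤ → (κ →₀ ℝ) →ₗ[ℝ] H := fun t => Finsupp.linearCombination ℝ fun k => z k t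
  let V : Submodule ℝ H := (LinearMap.range (L 0)).topologicalClosure
  have hVc : CompleteSpace V := (Submodule.isClosed_topologicalClosure _).completeSpace_coe
  let e : (κ →₀ ℝ) →ₗ[ℝ] V :=
    (L 0).codRestrict V fun a => Submodule.le_topologicalClosure _ ⟨a, rfl⟩
  have he : DenseRange e := by
    intro v
    rw [closure_subtype]
    have : (Subtype.val '' Set.range e : Set H) = LinearMap.range (L 0) := by
      ext h
      simp [e]
    rw [this]
    exact v.2
  have hL : ∀ a b t s h, inner ℝ (L (t + h) a) (L (s + h) b) = inner ℝ (L t a) (L s b) := by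
    intro a b t s h
    simp only [L, Finsupp.linearCombination_apply, Finsupp.sum, sum_inner, inner_sum,
      inner_smul_left, inner_smul_right, hz]
  -- Stationarity makes the norm of a combination independent of time, so sending its value at time
  -- 0 to its value at time `t` is well defined and isometric.
  have hnorm : ∀ t a, ‖L t a‖ = ‖e a‖ := by
    intro t a
    have h1 : inner ℝ (L t a) (L t a) = inner ℝ (L 0 a) (L 0 a) := by
      simpa using hL a a 0 0 t
    rw [real_inner_self_eq_norm_sq, real_inner_self_eq_norm_sq] at h1
    exact (sq_eq_sq₀ (norm_nonneg _) (norm_nonneg _)).1 h1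
  let Φ₀ : ℤ → V →L[ℝ] H := fun t => (L t).extendOfNorm e
  have hΦ₀ : ∀ t a, Φ₀ t (e a) = L t a := fun t a =>
    LinearMap.extendOfNorm_eq he ⟨1, fun a => by rw [hnorm, one_mul]⟩ a
  let Φ : ℤ → V →ₗᵢ[ℝ] H := fun t =>
    { toLinearMap := (Φ₀ t).toLinearMap
      norm_map' := fun v => by
        refine he.induction_on v (isClosed_eq (Φ₀ t).continuous.norm continuous_norm) fun a => ?_
        change ‖Φ₀ t (e a)‖ = ‖e a‖
        rw [hΦ₀, hnorm] }
  have hΦ : ∀ t a, Φ t (e a) = L t a := hΦ₀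
  have hΦcont : ∀ t, Continuous (Φ t) := fun t => (Φ t).continuous
  let θ' : ι → (κ →₀ ℝ) →ₗ[ℝ] (κ →₀ ℝ) := fun σ => Finsupp.lmapDomain ℝ ℝ (θ σ)
  have hML : ∀ σ t a, M σ t (L t a) = L (t + 1) (θ' σ a) := by
    intro σ t a
    change _ = Finsupp.linearCombination ℝ (fun k => z k (t + 1)) (Finsupp.mapDomain (θ σ) a)
    rw [Finsupp.linearCombination_mapDomain]
    simp only [L, Finsupp.linearCombination_apply, Finsupp.sum, map_sum, map_smul, hM,
      Function.comp_apply]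
  -- `V` sits at time 0, and the operators advance time by one: a vector is therefore read at time
  -- `-1`, so that its image lands in `V` again.
  have hmem : ∀ σ v, M σ (-1) (Φ (-1) v) ∈ V := by
    intro σ v
    refine he.induction_on v ((Submodule.isClosed_topologicalClosure _).preimage
      ((M σ (-1)).continuous.comp (hΦcont (-1)))) fun a => ?_
    rw [hΦ, hML]
    exact Submodule.le_topologicalClosure _ ⟨θ' σ a, by simp⟩
  let T : ι → V →L[ℝ] V := fun σ =>
    ((M σ (-1)).comp (Φ (-1)).toContinuousLinearMap).codRestrict V (hmem σ)
  have hT : ∀ σ a, T σ (e a) = e (θ' σ a) := by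
    intro σ a
    apply Subtype.ext
    change M σ (-1) (Φ (-1) (e a)) = L 0 (θ' σ a)
    rw [hΦ, hML]
    rfl
  refine ⟨V, Φ, T, fun k => e (Finsupp.single k 1), hVc, ?_, ?_, ?_, ?_⟩
  · intro k t
    rw [hΦ]
    simp [L]
  · intro σ t v
    refine he.induction_on v (isClosed_eq ((hΦcont _).comp (T σ).continuous)
      ((M σ t).continuous.comp (hΦcont t))) fun a => ?_
    rw [hT, hΦ, hΦ, hML]
  · intro v v' t s h
    refine he.induction_on v (isClosed_eq (by fun_prop) (by fun_prop)) fun a => ?_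
    refine he.induction_on v' (isClosed_eq (by fun_prop) (by fun_prop)) fun b => ?_
    simp only [hΦ, hL]
  · intro t v
    refine he.induction_on v ((Submodule.isClosed_topologicalClosure _).preimage (hΦcont t))
      fun a => ?_
    rw [hΦ]
    refine Submodule.le_topologicalClosure _ ?_
    rw [Finsupp.mem_span_range_iff_exists_finsupp]
    exact ⟨a, rfl⟩

end StationarySpace

/-! ### Words, inner products and generated σ-algebras -/

section Words

variable {Ω : Type*} {d : ℕ} (μ : ℤ → Ω → Fin d → ℝ) {p : Fin d → ℝ}

theorem muWord_append_singleton (w : List (Fin d)) (σ : Fin d) (t : ℤ) (ω : Ω) :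
    muWord μ (w ++ [σ]) t ω = muWord μ w (t - 1) ω * μ t ω σ := by
  induction w with
  | nil => simp [muWord]
  | cons τ w ih =>
    simp only [List.cons_append, muWord, ih, List.length_append, List.length_singleton]
    rw [show t - ((w.length + 1 : ℕ) : ℤ) = t - 1 - w.length by push_cast; ring, mul_assoc]

theorem zProc_append_singleton (hp : ∀ σ, 0 < p σ) {ι : Type*} (r : ℤ → Ω → ι → ℝ)
    (w : List (Fin d)) (σ : Fin d) (t : ℤ) (ω : Ω) (i : ι) :
    zProc μ p r (w ++ [σ]) (t + 1) ω i =
      zProc μ p r w t ω i * μ t ω σ * (1 / Real.sqrt (p σ)) := by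
  simp only [zProc, List.length_append, List.length_singleton, pWord, List.map_append,
    List.prod_append, List.map_singleton, List.prod_singleton]
  rw [Real.sqrt_mul' _ (hp σ).le, show t + 1 - ((w.length + 1 : ℕ) : ℤ) = t - w.length by
    push_cast; ring, add_sub_cancel_right, muWord_append_singleton,
    one_div, mul_inv]
  ring

theorem zProc_nil {ι : Type*} (r : ℤ → Ω → ι → ℝ) (t : ℤ) (ω : Ω) (i : ι) :
    zProc μ p r [] t ω i = r t ω i := by
  simp [zProc, muWord, pWord]

end Words

section Inner

variable {Ω : Type*} [MeasurableSpace Ω] {P : Measure Ω}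

theorem inner_eq_integral {f g : Lp ℝ 2 P} {f' g' : Ω → ℝ} (hf : f =ᵐ[P] f') (hg : g =ᵐ[P] g') :
    inner ℝ f g = ∫ ω, f' ω * g' ω ∂P := by
  rw [L2.inner_def]
  refine integral_congr_ae ?_
  filter_upwards [hf, hg] with ω h1 h2
  rw [h1, h2, RCLike.inner_apply, conj_trivial, mul_comm]

end Inner

section SigmaGen

variable {Ω : Type*} {ι : Type*} {r : ℤ → Ω → ι → ℝ}

theorem measurable_sigmaGen {T : Set ℤ} {k : ℤ} (hk : k ∈ T) (i : ι) :
    Measurable[sigmaGen r T] fun ω => r k ω i :=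
  (measurable_pi_apply i).comp ((comap_measurable (r k)).mono (le_iSup₂_of_le k hk le_rfl) le_rfl)

variable [m0 : MeasurableSpace Ω]

theorem sigmaGen_le (hr : ∀ t, Measurable (r t)) (T : Set ℤ) : sigmaGen r T ≤ m0 :=
  iSup₂_le fun k _ => (hr k).comap_le

end SigmaGen

theorem sigmaGen_mono {Ω ι : Type*} (r : ℤ → Ω → ι → ℝ) {T T' : Set ℤ} (h : T ⊆ T') :
    sigmaGen r T ≤ sigmaGen r T' :=
  biSup_mono fun _ hk => h hk

/-! ### Bounded multiplication by the switching process -/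

section Admissible

variable {Ω : Type*} [m0 : MeasurableSpace Ω] {P : Measure Ω} {d : ℕ}
  {μ : ℤ → Ω → Fin d → ℝ} {E : Set (Fin d × Fin d)} {p : Fin d → ℝ}

namespace IsAdmissible

variable (hμ : IsAdmissible P μ E p)
include hμ

theorem memLp_muWord {w : List (Fin d)} (hw : w ≠ []) (t : ℤ) : MemLp (muWord μ w t) 2 P := by
  simpa using (hμ.wss w w hw hw).memLp true t

theorem memLp_mu (t : ℤ) (σ : Fin d) : MemLp (fun ω => μ t ω σ) 2 P := by
  have := hμ.memLp_muWord (w := [σ]) (by simp) t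
  simpa [muWord, Function.comp_def] using! this

theorem integrable_mu_mul (t : ℤ) (σ σ' : Fin d) : Integrable (fun ω => μ t ω σ * μ t ω σ') P :=
  (hμ.memLp_mu t σ).integrable_mul (hμ.memLp_mu t σ')

open Classical in
theorem mu_mul_condExp_sq (τ σ : Fin d) (t : ℤ) :
    ∀ᵐ ω ∂P, μ (t - 1) ω τ * P[fun ω => μ t ω σ * μ t ω σ | sigmaGen μ (Set.Iio t)] ω =
      if (τ, σ) ∈ E then p σ * μ (t - 1) ω τ else 0 := by
  have h1 := hμ.condExp_word_letter [τ] (by simp) σ σ t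
  have hfun : (fun ω => muWord μ ([τ] ++ [σ]) t ω * μ t ω σ) =
      (fun ω => μ (t - 1) ω τ) * fun ω => μ t ω σ * μ t ω σ := by
    ext ω
    simp [muWord, mul_assoc]
  have hint : Integrable ((fun ω => μ (t - 1) ω τ) * fun ω => μ t ω σ * μ t ω σ) P := by
    rw [← hfun]
    exact (hμ.memLp_muWord (by simp) t).integrable_mul (hμ.memLp_mu t σ)
  have hmeas : StronglyMeasurable[sigmaGen μ (Set.Iio t)] fun ω => μ (t - 1) ω τ :=
    (measurable_sigmaGen (by simp) τ).stronglyMeasurable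
  have h2 := condExp_mul_of_stronglyMeasurable_left hmeas hint (hμ.integrable_mu_mul t σ σ)
  rw [hfun] at h1
  filter_upwards [h1, h2] with ω h1 h2
  rw [h2] at h1
  refine Eq.trans (by simp) (h1.trans ?_)
  by_cases hE : (τ, σ) ∈ E <;> simp [AdmissibleWord, hE, muWord]

/-- Let `g` be the conditional second moment. Each `μ_τ(t-1) g` is `p_σ μ_τ(t-1)` or `0`; weighting
by `α_τ` and summing to one gives `g² = p_σ g`, so `g` takes only the values `0` and `p_σ`. -/
theorem condExp_sq_le (σ : Fin d) (t : ℤ) :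
    ∀ᵐ ω ∂P, P[fun ω => μ t ω σ * μ t ω σ | sigmaGen μ (Set.Iio t)] ω ≤ p σ := by
  classical
  obtain ⟨α, hα⟩ := hμ.exists_sum_eq_one
  have h := ae_all_iff.2 fun τ => hμ.mu_mul_condExp_sq τ σ t
  filter_upwards [h, hα (t - 1)] with ω h hα
  set g := P[fun ω => μ t ω σ * μ t ω σ | sigmaGen μ (Set.Iio t)] ω
  have hg : g = ∑ τ, α τ * (μ (t - 1) ω τ * g) := by
    simp_rw [← mul_assoc, ← Finset.sum_mul, hα, one_mul]
  have hgg : g * g = p σ * g := by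
    nth_rw 1 [hg]
    nth_rw 3 [hg]
    rw [Finset.sum_mul, Finset.mul_sum]
    refine Finset.sum_congr rfl fun τ _ => ?_
    rw [h τ]
    split_ifs with hE
    · have := h τ
      rw [if_pos hE] at this
      rw [mul_assoc, mul_assoc (p σ), this]
      ring
    · simp
  rcases mul_eq_mul_right_iff.1 hgg with h | h
  · exact h.le
  · rw [h]
    exact (hμ.p_pos σ).le

end IsAdmissible

variable {ι : Type*} {r : ℤ → Ω → ι → ℝ}

/-- The σ-algebra generated by the switching process before time `t` and by `r` up to time `t`. -/
abbrev history (μ : ℤ → Ω → Fin d → ℝ) (r : ℤ → Ω → ι → ℝ) (t : ℤ) : MeasurableSpace Ω :=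
  sigmaGen μ (Set.Iio t) ⊔ sigmaGen r (Set.Iic t)

omit m0 in
theorem history_mono {s t : ℤ} (h : s ≤ t) : history μ r s ≤ history μ r t :=
  sup_le_sup (sigmaGen_mono μ (Set.Iio_subset_Iio h)) (sigmaGen_mono r (Set.Iic_subset_Iic.2 h))

omit m0 in
theorem measurable_history_mu (t : ℤ) (σ : Fin d) :
    Measurable[history μ r (t + 1)] fun ω => μ t ω σ :=
  (measurable_sigmaGen (by simp) σ).mono le_sup_left le_rfl

omit m0 in
theorem measurable_history_self (t : ℤ) (i : ι) : Measurable[history μ r t] fun ω => r t ω i :=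
  (measurable_sigmaGen (by simp) i).mono le_sup_right le_rfl

section History

variable [IsProbabilityMeasure P] (hμ : IsAdmissible P μ E p) (hr : IsZMWSSI P μ p r)
include hμ hr

omit [IsProbabilityMeasure P] in
theorem history_le (t : ℤ) : history μ r t ≤ m0 :=
  sup_le (sigmaGen_le hμ.measurable _) (sigmaGen_le hr.measurable _)

/-- For functions of the present and future of `μ`, the values of `r` up to `t` add nothing to the
past of `μ`: this is the conditional independence in ZMWSSI. -/
theorem condExp_history {t : ℤ} {f : Ω → ℝ} (hf : Integrable f P)
    (hfm : AEStronglyMeasurable[sigmaGen μ (Set.Ici t)] f P) :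
    P[f | history μ r t] =ᵐ[P] P[f | sigmaGen μ (Set.Iio t)] :=
  (hr.condIndep t).condExp_sup (sigmaGen_le hμ.measurable _) (sigmaGen_le hr.measurable _)
    (sigmaGen_le hμ.measurable _) hf hfm

theorem condExp_history_mu_mul (t : ℤ) (σ σ' : Fin d) :
    P[fun ω => μ t ω σ * μ t ω σ' | history μ r t] =ᵐ[P]
      P[fun ω => μ t ω σ * μ t ω σ' | sigmaGen μ (Set.Iio t)] := by
  refine condExp_history hμ hr (hμ.integrable_mu_mul t σ σ') ?_
  have h : ∀ σ, Measurable[sigmaGen μ (Set.Ici t)] fun ω => μ t ω σ := fun σ =>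
    measurable_sigmaGen (by simp) σ
  exact ((h σ).mul (h σ')).stronglyMeasurable.aestronglyMeasurable

theorem memLp_mul_mu {t : ℤ} (σ : Fin d) {f : Ω → ℝ} (hf : MemLp f 2 P)
    (hfm : AEStronglyMeasurable[history μ r t] f P) : MemLp (fun ω => f ω * μ t ω σ) 2 P := by
  refine memLp_mul_of_condExp_sq_le (history_le hμ hr t) hf hfm (hμ.memLp_mu t σ) (C := p σ) ?_
  filter_upwards [condExp_history_mu_mul hμ hr t σ σ, hμ.condExp_sq_le σ t] with ω h1 h2
  rwa [h1]

theorem condExp_mul_mu_mul_mu {t : ℤ} (σ σ' : Fin d) {f g : Ω → ℝ} (hf : MemLp f 2 P)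
    (hfm : AEStronglyMeasurable[history μ r t] f P) (hg : MemLp g 2 P)
    (hgm : AEStronglyMeasurable[history μ r t] g P) :
    P[fun ω => (f ω * μ t ω σ) * (g ω * μ t ω σ') | history μ r t] =ᵐ[P] fun ω =>
      f ω * g ω * P[fun ω => μ t ω σ * μ t ω σ' | sigmaGen μ (Set.Iio t)] ω := by
  have heq : (fun ω => (f ω * μ t ω σ) * (g ω * μ t ω σ')) =
      (fun ω => f ω * g ω) * fun ω => μ t ω σ * μ t ω σ' := by
    ext ω
    simp only [Pi.mul_apply]
    ring
  have hint : Integrable (fun ω => (f ω * μ t ω σ) * (g ω * μ t ω σ')) P :=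
    (memLp_mul_mu hμ hr σ hf hfm).integrable_mul (memLp_mul_mu hμ hr σ' hg hgm)
  rw [heq] at hint ⊢
  exact (condExp_mul_of_aestronglyMeasurable_left (hfm.mul hgm) hint
    (hμ.integrable_mu_mul t σ σ')).trans
    ((Filter.EventuallyEq.refl _ _).mul (condExp_history_mu_mul hμ hr t σ σ'))

theorem integral_mul_mu_mul_mu {t : ℤ} (σ σ' : Fin d) {f g : Ω → ℝ} (hf : MemLp f 2 P)
    (hfm : AEStronglyMeasurable[history μ r t] f P) (hg : MemLp g 2 P)
    (hgm : AEStronglyMeasurable[history μ r t] g P) :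
    ∫ ω, (f ω * μ t ω σ) * (g ω * μ t ω σ') ∂P =
      ∫ ω, f ω * g ω * P[fun ω => μ t ω σ * μ t ω σ' | sigmaGen μ (Set.Iio t)] ω ∂P := by
  rw [← integral_condExp (history_le hμ hr t)]
  exact integral_congr_ae (condExp_mul_mu_mul_mu hμ hr σ σ' hf hfm hg hgm)

theorem integral_mul_mu_mul_mu_of_ne {t : ℤ} {σ σ' : Fin d} (hσ : σ ≠ σ') {f g : Ω → ℝ}
    (hf : MemLp f 2 P) (hfm : AEStronglyMeasurable[history μ r t] f P) (hg : MemLp g 2 P)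
    (hgm : AEStronglyMeasurable[history μ r t] g P) :
    ∫ ω, (f ω * μ t ω σ) * (g ω * μ t ω σ') ∂P = 0 := by
  rw [integral_mul_mu_mul_mu hμ hr σ σ' hf hfm hg hgm]
  refine integral_eq_zero_of_ae ?_
  filter_upwards [hμ.condExp_letter_letter σ σ' t hσ] with ω h
  simp [h]

theorem integral_mul_mu_sq_le {t : ℤ} (σ : Fin d) {f : Ω → ℝ} (hf : MemLp f 2 P)
    (hfm : AEStronglyMeasurable[history μ r t] f P) :
    ∫ ω, (f ω * μ t ω σ) * (f ω * μ t ω σ) ∂P ≤ p σ * ∫ ω, f ω * f ω ∂P := by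
  rw [integral_mul_mu_mul_mu hμ hr σ σ hf hfm hf hfm, ← integral_const_mul]
  refine integral_mono_ae
    (integrable_condExp.congr (condExp_mul_mu_mul_mu hμ hr σ σ hf hfm hf hfm))
    ((hf.integrable_mul hf).const_mul _) ?_
  filter_upwards [hμ.condExp_sq_le σ t] with ω h
  rw [mul_comm (p σ)]
  exact mul_le_mul_of_nonneg_left h (mul_self_nonneg _)

theorem integral_mul_mu_mul_mu_of_mem {t : ℤ} {τ σ : Fin d} (hE : (τ, σ) ∈ E) {f g : Ω → ℝ}
    (hf : MemLp f 2 P) (hfm : AEStronglyMeasurable[history μ r (t - 1)] f P)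
    (hg : MemLp g 2 P) (hgm : AEStronglyMeasurable[history μ r t] g P) :
    ∫ ω, (f ω * μ (t - 1) ω τ * μ t ω σ) * (g ω * μ t ω σ) ∂P =
      p σ * ∫ ω, f ω * μ (t - 1) ω τ * g ω ∂P := by
  have hmeas : Measurable[history μ r t] fun ω => μ (t - 1) ω τ := by
    have := measurable_history_mu (μ := μ) (r := r) (t - 1) τ
    rwa [sub_add_cancel] at this
  have hfm' : AEStronglyMeasurable[history μ r t] (fun ω => f ω * μ (t - 1) ω τ) P :=
    (hfm.mono (history_mono (by simp))).mul hmeas.stronglyMeasurable.aestronglyMeasurable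
  rw [integral_mul_mu_mul_mu hμ hr σ σ (memLp_mul_mu hμ hr τ hf hfm) hfm' hg hgm,
    ← integral_const_mul]
  refine integral_congr_ae ?_
  filter_upwards [hμ.mu_mul_condExp_sq τ σ t] with ω h
  rw [if_pos hE] at h
  linear_combination f ω * g ω * h

/-- Multiplication by `μ_σ(t) / √p_σ` is a bounded operator on the square integrable functions of
the history. -/
theorem exists_mulOp (σ : Fin d) (t : ℤ) :
    ∃ M : Lp ℝ 2 P →L[ℝ] Lp ℝ 2 P, ∀ f : Lp ℝ 2 P, AEStronglyMeasurable[history μ r t] f P →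
      M f =ᵐ[P] fun ω => f ω * μ t ω σ * (1 / Real.sqrt (p σ)) := by
  have : Fact (history μ r t ≤ m0) := ⟨history_le hμ hr t⟩
  have hp := hμ.p_pos σ
  have hmem : ∀ f : lpMeas ℝ ℝ (history μ r t) 2 P,
      MemLp (fun ω => (f : Lp ℝ 2 P) ω * μ t ω σ * (1 / Real.sqrt (p σ))) 2 P := fun f =>
    (memLp_mul_mu hμ hr σ (Lp.memLp (f : Lp ℝ 2 P)) (lpMeas.aestronglyMeasurable f)).mul_const _
  let N : lpMeas ℝ ℝ (history μ r t) 2 P →ₗ[ℝ] Lp ℝ 2 P :=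
    { toFun := fun f => (hmem f).toLp _
      map_add' := fun f g => by
        rw [← MemLp.toLp_add]
        refine MemLp.toLp_congr _ _ ?_
        filter_upwards [Lp.coeFn_add (f : Lp ℝ 2 P) (g : Lp ℝ 2 P)] with ω h
        simp only [Submodule.coe_add, h, Pi.add_apply]
        ring
      map_smul' := fun c f => by
        rw [RingHom.id_apply, ← MemLp.toLp_const_smul]
        refine MemLp.toLp_congr _ _ ?_
        filter_upwards [Lp.coeFn_smul c (f : Lp ℝ 2 P)] with ω h
        simp only [Submodule.coe_smul, h, Pi.smul_apply, smul_eq_mul]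
        ring }
  have hN : ∀ f, ‖N f‖ ≤ 1 * ‖f‖ := by
    intro f
    rw [one_mul, ← Submodule.norm_coe, ← sq_le_sq₀ (norm_nonneg _) (norm_nonneg _),
      ← real_inner_self_eq_norm_sq, ← real_inner_self_eq_norm_sq,
      inner_eq_integral (f := N f) (g := N f) (hmem f).coeFn_toLp (hmem f).coeFn_toLp,
      inner_eq_integral (Filter.EventuallyEq.refl _ _) (Filter.EventuallyEq.refl _ _)]
    have h1 := integral_mul_mu_sq_le hμ hr σ (Lp.memLp (f : Lp ℝ 2 P))
      (lpMeas.aestronglyMeasurable f)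
    have h2 : (1 / Real.sqrt (p σ)) * (1 / Real.sqrt (p σ)) = (p σ)⁻¹ := by
      rw [div_mul_div_comm, Real.mul_self_sqrt hp.le, one_mul, one_div]
    calc _ = (p σ)⁻¹ * ∫ ω, ((f : Lp ℝ 2 P) ω * μ t ω σ) * ((f : Lp ℝ 2 P) ω * μ t ω σ) ∂P := by
          rw [← integral_const_mul, ← h2]
          congr 1 with ω
          ring
      _ ≤ (p σ)⁻¹ * (p σ * ∫ ω, (f : Lp ℝ 2 P) ω * (f : Lp ℝ 2 P) ω ∂P) := by gcongr
      _ = _ := by rw [inv_mul_cancel_left₀ hp.ne']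
  -- The estimate holds only on functions of the history; precomposing with the projection onto them
  -- gives an operator on all of `L²`.
  refine ⟨(N.mkContinuous 1 hN).comp
    (lpMeas ℝ ℝ (history μ r t) 2 P).orthogonalProjectionOnto, fun f hf => ?_⟩
  have hf' : f ∈ lpMeas ℝ ℝ (history μ r t) 2 P := mem_lpMeas_iff_aestronglyMeasurable.2 hf
  have hproj : (lpMeas ℝ ℝ (history μ r t) 2 P).orthogonalProjectionOnto f = ⟨f, hf'⟩ :=
    Submodule.orthogonalProjectionOnto_mem_subspace_eq_self (⟨f, hf'⟩ : lpMeas ℝ ℝ _ 2 P)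
  rw [ContinuousLinearMap.comp_apply, hproj]
  exact (hmem ⟨f, hf'⟩).coeFn_toLp

end History

end Admissible

/-! ### Stationary processes as vectors -/

section Representation

variable {Ω : Type*} [m0 : MeasurableSpace Ω] {P : Measure Ω} {d : ℕ}
  {μ : ℤ → Ω → Fin d → ℝ} {E : Set (Fin d × Fin d)} {p : Fin d → ℝ}
  {ι κ κ' : Type*} {r : ℤ → Ω → ι → ℝ}
  {V : Type*} [NormedAddCommGroup V] [InnerProductSpace ℝ V]

/-- The Hilbert space `V` consists of stationary processes adapted to the history of `r`: the vector
`a` stands for the process `t ↦ Φ t a`, and `T σ` multiplies by `μ_σ / √p_σ` and shifts the time. -/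
structure IsProcessSpace (P : Measure Ω) (μ : ℤ → Ω → Fin d → ℝ) (p : Fin d → ℝ)
    (r : ℤ → Ω → ι → ℝ) (Φ : ℤ → V →ₗᵢ[ℝ] Lp ℝ 2 P) (T : Fin d → V →L[ℝ] V) : Prop where
  apply_ae : ∀ σ t a,
    Φ (t + 1) (T σ a) =ᵐ[P] fun ω => Φ t a ω * μ t ω σ * (1 / Real.sqrt (p σ))
  inner_shift : ∀ a b t s h, inner ℝ (Φ (t + h) a) (Φ (s + h) b) = inner ℝ (Φ t a) (Φ s b)
  measurable : ∀ t a, AEStronglyMeasurable[history μ r t] (Φ t a) P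
  integral_eq_zero : ∀ t a, ∫ ω, Φ t a ω ∂P = 0

/-- The vectors `R i` of `V` stand for the coordinates of the process `r`. -/
def Represents (Φ : ℤ → V →ₗᵢ[ℝ] Lp ℝ 2 P) (r : ℤ → Ω → κ → ℝ) (R : κ → V) : Prop :=
  ∀ t i, (fun ω => r t ω i) =ᵐ[P] Φ t (R i)

omit m0 in
theorem measurable_history_zProc (hp : ∀ σ, 0 < p σ) (w : List (Fin d)) (t : ℤ) (i : ι) :
    Measurable[history μ r t] fun ω => zProc μ p r w t ω i := by
  induction w using List.reverseRecOn generalizing t with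
  | nil =>
    simp only [zProc_nil]
    exact measurable_history_self t i
  | append_singleton w σ ih =>
    obtain ⟨s, rfl⟩ : ∃ s, t = s + 1 := ⟨t - 1, by simp⟩
    simp only [zProc_append_singleton μ hp]
    exact (((ih s).mono (history_mono (by simp)) le_rfl).mul
      (measurable_history_mu s σ)).mul_const _

/-- The stationary family is indexed by a word and a coordinate, and multiplication by `μ_σ / √p_σ`
appends the letter `σ`. Adaptedness and zero mean pass from the generators to closed spans. -/
theorem exists_processSpace [IsProbabilityMeasure P] (hμ : IsAdmissible P μ E p)
    (hr : IsZMWSSI P μ p r) :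
    ∃ (V : Submodule ℝ (Lp ℝ 2 P)) (Φ : ℤ → V →ₗᵢ[ℝ] Lp ℝ 2 P) (T : Fin d → V →L[ℝ] V)
      (R : ι → V), CompleteSpace V ∧ IsProcessSpace P μ p r Φ T ∧ Represents Φ r R := by
  choose M hM using exists_mulOp hμ hr
  have hmem : ∀ (k : List (Fin d) × ι) t, MemLp (fun ω => zProc μ p r k.1 t ω k.2) 2 P :=
    hr.wss.memLp
  let z : List (Fin d) × ι → ℤ → Lp ℝ 2 P := fun k t => (hmem k t).toLp _
  have hz : ∀ k t, z k t =ᵐ[P] fun ω => zProc μ p r k.1 t ω k.2 := fun k t =>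
    (hmem k t).coeFn_toLp
  have hzm : ∀ k t, AEStronglyMeasurable[history μ r t] (z k t) P := fun k t =>
    (measurable_history_zProc hμ.p_pos k.1 t k.2).stronglyMeasurable.aestronglyMeasurable.congr
      (hz k t).symm
  have hMz : ∀ σ k t, M σ t (z k t) = z (k.1 ++ [σ], k.2) (t + 1) := by
    intro σ k t
    apply Lp.ext
    filter_upwards [hM σ t _ (hzm k t), hz k t, hz (k.1 ++ [σ], k.2) (t + 1)] with ω h1 h2 h3
    rw [h1, h2, h3, zProc_append_singleton μ hμ.p_pos]
  obtain ⟨V, Φ, T, Z, hV, hΦz, hΦT, hΦs, hΦm⟩ := exists_stationary_space z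
    (fun k l t s h => by
      rw [inner_eq_integral (hz _ _) (hz _ _), inner_eq_integral (hz _ _) (hz _ _)]
      exact hr.wss.cov k l t s h)
    M (fun σ k => (k.1 ++ [σ], k.2)) hMz
  have hmeas : ∀ t a, AEStronglyMeasurable[history μ r t] (Φ t a) P := by
    intro t a
    have : Fact (history μ r t ≤ m0) := ⟨history_le hμ hr t⟩
    have hclosed : IsClosed (lpMeas ℝ ℝ (history μ r t) 2 P : Set (Lp ℝ 2 P)) :=
      (completeSpace_coe_iff_isComplete.1
        (inferInstanceAs (CompleteSpace (lpMeas ℝ ℝ (history μ r t) 2 P)))).isClosed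
    have hle : (Submodule.span ℝ (Set.range fun k => z k t)).topologicalClosure ≤
        lpMeas ℝ ℝ (history μ r t) 2 P := by
      refine Submodule.topologicalClosure_minimal _ (Submodule.span_le.2 ?_) hclosed
      rintro _ ⟨k, rfl⟩
      exact mem_lpMeas_iff_aestronglyMeasurable.2 (hzm k t)
    exact mem_lpMeas_iff_aestronglyMeasurable.1 (hle (hΦm t a))
  refine ⟨V, Φ, T, fun i => Z ([], i), hV, ⟨fun σ t a => ?_, hΦs, hmeas, fun t a => ?_⟩,
    fun t i => ?_⟩
  · rw [hΦT]
    exact hM σ t _ (hmeas t a)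
  · have h1 : MemLp (fun _ : Ω => (1 : ℝ)) 2 P := memLp_const 1
    have h2 : ∀ f : Lp ℝ 2 P, innerSL ℝ (h1.toLp _) f = ∫ ω, f ω ∂P := fun f => by
      change inner ℝ (h1.toLp _) f = _
      rw [inner_eq_integral h1.coeFn_toLp (Filter.EventuallyEq.refl _ _)]
      simp
    rw [← h2]
    refine map_eq_zero_of_mem_closure_span _ ?_ (hΦm t a)
    rintro _ ⟨k, rfl⟩
    rw [h2, integral_congr_ae (hz k t)]
    exact hr.zero_mean k.1 t k.2
  · rw [hΦz]
    refine .trans (.of_eq ?_) (hz ([], i) t).symm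
    simp only [zProc_nil]

namespace IsProcessSpace

variable {Φ : ℤ → V →ₗᵢ[ℝ] Lp ℝ 2 P} {T : Fin d → V →L[ℝ] V}

theorem apply_ae_sub (hΦ : IsProcessSpace P μ p r Φ T) (σ : Fin d) (t : ℤ) (a : V) :
    Φ t (T σ a) =ᵐ[P] fun ω => Φ (t - 1) a ω * μ (t - 1) ω σ * (1 / Real.sqrt (p σ)) := by
  have := hΦ.apply_ae σ (t - 1) a
  rwa [sub_add_cancel] at this

theorem exists_isSwitchingFamily [IsProbabilityMeasure P] (hΦ : IsProcessSpace P μ p r Φ T)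
    (hμ : IsAdmissible P μ E p) (hr : IsZMWSSI P μ p r) : ∃ a, IsSwitchingFamily T E a := by
  obtain ⟨α, hα⟩ := hμ.exists_sum_eq_one
  have hLp : ∀ t f, MemLp (Φ t f) 2 P := fun t f => Lp.memLp _
  have hne : ∀ σ σ' f g, σ ≠ σ' → inner ℝ (T σ f) (T σ' g) = 0 := by
    intro σ σ' f g hσ
    rw [← (Φ (1 + 1)).inner_map_map, inner_eq_integral (hΦ.apply_ae σ 1 f) (hΦ.apply_ae σ' 1 g)]
    have h := integral_mul_mu_mul_mu_of_ne hμ hr hσ (hLp 1 f) (hΦ.measurable 1 f) (hLp 1 g)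
      (hΦ.measurable 1 g)
    calc _ = ∫ ω, (1 / Real.sqrt (p σ)) * (1 / Real.sqrt (p σ')) *
          ((Φ 1 f ω * μ 1 ω σ) * (Φ 1 g ω * μ 1 ω σ')) ∂P := by
          congr 1 with ω
          ring
      _ = 0 := by rw [integral_const_mul, h, mul_zero]
  have hsq : ∀ σ, (1 / Real.sqrt (p σ)) * (1 / Real.sqrt (p σ)) * p σ = 1 := fun σ => by
    have hp := hμ.p_pos σ
    rw [div_mul_div_comm, Real.mul_self_sqrt hp.le, one_mul, one_div, inv_mul_cancel₀ hp.ne']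
  -- These weights come from `1 = ∑ α_σ μ_σ`: it writes `f` as `∑ α_σ √p_σ T σ f` with mutually
  -- orthogonal terms.
  refine ⟨fun σ => α σ ^ 2 * p σ, hne, ?_, ?_, ?_⟩
  · intro τ σ f g hE
    have hcomp : Φ (1 + 1) (T σ (T τ f)) =ᵐ[P] fun ω => Φ (1 - 1) f ω * μ (1 - 1) ω τ *
        (1 / Real.sqrt (p τ)) * μ 1 ω σ * (1 / Real.sqrt (p σ)) := by
      filter_upwards [hΦ.apply_ae σ 1 (T τ f), hΦ.apply_ae_sub τ 1 f] with ω h1 h2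
      rw [h1, h2]
    rw [← (Φ (1 + 1)).inner_map_map, ← (Φ 1).inner_map_map,
      inner_eq_integral hcomp (hΦ.apply_ae σ 1 g),
      inner_eq_integral (hΦ.apply_ae_sub τ 1 f) (Filter.EventuallyEq.refl _ _)]
    have h := integral_mul_mu_mul_mu_of_mem hμ hr hE (hLp (1 - 1) f) (hΦ.measurable (1 - 1) f)
      (hLp 1 g) (hΦ.measurable 1 g)
    calc _ = ∫ ω, (1 / Real.sqrt (p τ)) * ((1 / Real.sqrt (p σ)) * (1 / Real.sqrt (p σ))) *
          ((Φ (1 - 1) f ω * μ (1 - 1) ω τ * μ 1 ω σ) * (Φ 1 g ω * μ 1 ω σ)) ∂P := by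
          congr 1 with ω
          ring
      _ = (1 / Real.sqrt (p τ)) * ((1 / Real.sqrt (p σ)) * (1 / Real.sqrt (p σ)) * p σ) *
          ∫ ω, Φ (1 - 1) f ω * μ (1 - 1) ω τ * Φ 1 g ω ∂P := by
          rw [integral_const_mul, h]
          ring
      _ = _ := by
          rw [hsq, mul_one, ← integral_const_mul]
          congr 1 with ω
          ring
  · intro τ σ f hE
    apply (Φ (1 + 1)).injective
    rw [map_zero]
    apply Lp.ext
    have h0 := hμ.eq_zero ([τ] ++ [σ]) (by simp) (by simpa [AdmissibleWord] using hE) 1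
    filter_upwards [hΦ.apply_ae σ 1 (T τ f), hΦ.apply_ae_sub τ 1 f, h0, Lp.coeFn_zero ℝ 2 P]
      with ω h1 h2 h3 h4
    rw [muWord_append_singleton] at h3
    have h5 : μ (1 - 1) ω τ * μ 1 ω σ = 0 := by simpa [muWord] using h3
    rw [h1, h2, h4, Pi.zero_apply]
    linear_combination Φ (1 - 1) f ω * (1 / Real.sqrt (p τ)) * (1 / Real.sqrt (p σ)) * h5
  · have hdec : ∀ f, Φ 1 f = ∑ σ, (α σ * Real.sqrt (p σ)) • Φ (1 + 1) (T σ f) := by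
      intro f
      apply Lp.ext
      have h1 := ae_all_iff.2 fun σ => hΦ.apply_ae σ 1 f
      have h2 := ae_all_iff.2 fun σ => Lp.coeFn_smul (α σ * Real.sqrt (p σ)) (Φ (1 + 1) (T σ f))
      filter_upwards [h1, h2, hα 1, Lp.coeFn_fun_finsetSum Finset.univ
        fun σ => (α σ * Real.sqrt (p σ)) • Φ (1 + 1) (T σ f)] with ω h1 h2 h3 h4
      rw [h4]
      calc Φ 1 f ω = Φ 1 f ω * ∑ σ, α σ * μ 1 ω σ := by rw [h3, mul_one]
        _ = _ := by
          rw [Finset.mul_sum]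
          refine Finset.sum_congr rfl fun σ _ => ?_
          rw [h2 σ, Pi.smul_apply, h1 σ, smul_eq_mul]
          have hp : Real.sqrt (p σ) ≠ 0 := (Real.sqrt_pos.2 (hμ.p_pos σ)).ne'
          field_simp
    intro f g
    rw [← (Φ 1).inner_map_map, hdec f, hdec g, sum_inner]
    refine Finset.sum_congr rfl fun σ _ => ?_
    rw [inner_sum, Finset.sum_eq_single σ]
    · rw [inner_smul_left, inner_smul_right, (Φ (1 + 1)).inner_map_map, conj_trivial]
      linear_combination α σ ^ 2 * inner ℝ (T σ f) (T σ g) * Real.mul_self_sqrt (hμ.p_pos σ).le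
    · intro σ' _ hσ'
      rw [inner_smul_left, inner_smul_right, (Φ (1 + 1)).inner_map_map, hne _ _ _ _ hσ'.symm,
        mul_zero, mul_zero]
    · simp

theorem sum_smul_apply_ae (hΦ : IsProcessSpace P μ p r Φ T) (hp : ∀ σ, 0 < p σ)
    (f : Fin d → V) (t : ℤ) :
    Φ (t + 1) (∑ σ, Real.sqrt (p σ) • T σ (f σ)) =ᵐ[P] fun ω => ∑ σ, μ t ω σ * Φ t (f σ) ω := by
  rw [map_sum]
  have h1 := ae_all_iff.2 fun σ => hΦ.apply_ae σ t (f σ)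
  have h2 := ae_all_iff.2 fun σ => Lp.coeFn_smul (Real.sqrt (p σ)) (Φ (t + 1) (T σ (f σ)))
  filter_upwards [h1, h2, Lp.coeFn_fun_finsetSum Finset.univ
    fun σ => Φ (t + 1) (Real.sqrt (p σ) • T σ (f σ))] with ω h1 h2 h3
  rw [h3]
  refine Finset.sum_congr rfl fun σ _ => ?_
  rw [map_smul, h2 σ, Pi.smul_apply, h1 σ, smul_eq_mul]
  have := (Real.sqrt_pos.2 (hp σ)).ne'
  field_simp

end IsProcessSpace

namespace Represents

variable {Φ : ℤ → V →ₗᵢ[ℝ] Lp ℝ 2 P} {T : Fin d → V →L[ℝ] V}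
  {q : ℤ → Ω → κ → ℝ} {q' : ℤ → Ω → κ' → ℝ} {Q : κ → V} {Q' : κ' → V}

theorem stack (hq : Represents Φ q Q) (hq' : Represents Φ q' Q') :
    Represents Φ (stack q q') (Sum.elim Q Q') := by
  rintro t (i | i)
  · exact hq t i
  · exact hq' t i

theorem lc_ae [Fintype κ] (hq : Represents Φ q Q) (M : Matrix κ' κ ℝ) (t : ℤ) (i : κ') :
    Φ t (lc M Q i) =ᵐ[P] fun ω => (M *ᵥ q t ω) i := by
  rw [lc, map_sum]
  have h1 := ae_all_iff.2 fun j => hq t j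
  have h2 := ae_all_iff.2 fun j => Lp.coeFn_smul (M i j) (Φ t (Q j))
  filter_upwards [h1, h2, Lp.coeFn_fun_finsetSum Finset.univ fun j => Φ t (M i j • Q j)]
    with ω h1 h2 h3
  rw [h3]
  refine Finset.sum_congr rfl fun j _ => ?_
  rw [map_smul, h2 j, Pi.smul_apply, ← h1 j, smul_eq_mul]

theorem zProc_ae (hq : Represents Φ q Q) (hΦ : IsProcessSpace P μ p r Φ T) (hp : ∀ σ, 0 < p σ)
    (w : List (Fin d)) (t : ℤ) (i : κ) :
    (fun ω => zProc μ p q w t ω i) =ᵐ[P] Φ t (wordOp T w (Q i)) := by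
  induction w using List.reverseRecOn generalizing t with
  | nil =>
    simp only [zProc_nil]
    exact hq t i
  | append_singleton w σ ih =>
    obtain ⟨s, rfl⟩ : ∃ s, t = s + 1 := ⟨t - 1, by simp⟩
    rw [wordOp_append_singleton]
    filter_upwards [hΦ.apply_ae σ s (wordOp T w (Q i)), ih s] with ω h1 h2
    rw [h1, zProc_append_singleton μ hp, h2]

theorem crossCov_zProc (hq : Represents Φ q Q) (hq' : Represents Φ q' Q')
    (hΦ : IsProcessSpace P μ p r Φ T) (hp : ∀ σ, 0 < p σ) (w w' : List (Fin d)) (t : ℤ) (i : κ)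
    (j : κ') : crossCov P (zProc μ p q w t) (zProc μ p q' w' t) i j =
      inner ℝ (wordOp T w (Q i)) (wordOp T w' (Q' j)) := by
  rw [← (Φ t).inner_map_map, inner_eq_integral (hq.zProc_ae hΦ hp w t i).symm
    (hq'.zProc_ae hΦ hp w' t j).symm]
  rfl

theorem crossCov_timesMu (hq : Represents Φ q Q) (hq' : Represents Φ q' Q')
    (hΦ : IsProcessSpace P μ p r Φ T) (hp : ∀ σ, 0 < p σ) (σ : Fin d) (t : ℤ) (i : κ) (j : κ') :
    crossCov P (timesMu μ σ q t) (timesMu μ σ q' t) i j =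
      p σ * inner ℝ (T σ (Q i)) (T σ (Q' j)) := by
  have hs := (Real.sqrt_pos.2 (hp σ)).ne'
  rw [← (Φ (t + 1)).inner_map_map,
    inner_eq_integral (hΦ.apply_ae σ t (Q i)) (hΦ.apply_ae σ t (Q' j)), ← integral_const_mul]
  refine integral_congr_ae ?_
  filter_upwards [hq t i, hq' t j] with ω h1 h2
  rw [← h1, ← h2]
  have h3 : (1 / Real.sqrt (p σ)) * (1 / Real.sqrt (p σ)) * p σ = 1 := by
    rw [div_mul_div_comm, Real.mul_self_sqrt (hp σ).le, one_mul, one_div,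
      inv_mul_cancel₀ (hp σ).ne']
  simp only [timesMu]
  linear_combination -(q t ω i * μ t ω σ * (q' t ω j * μ t ω σ)) * h3

/-- Any process represented in `V` inherits the property, since the space already encodes
adaptedness, zero mean and stationarity; only measurability of the chosen versions must be supplied.
-/
theorem isZMWSSI [IsProbabilityMeasure P] (hq : Represents Φ q Q)
    (hΦ : IsProcessSpace P μ p r Φ T) (hμ : IsAdmissible P μ E p) (hr : IsZMWSSI P μ p r)
    (hm : ∀ t, Measurable (q t)) : IsZMWSSI P μ p q where
  measurable := hm
  condIndep t := by
    refine condIndepGiven_of_condExp_eq (G := history μ r t) le_sup_left (history_le hμ hr t)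
      (sigmaGen_le hm _) (sigmaGen_le hμ.measurable _) (iSup₂_le fun k hk => ?_) fun s hs => ?_
    · rw [← measurable_iff_comap_le]
      refine @measurable_pi_lambda _ _ _ (eventuallyMeasurableSpace _ _) _ _ fun i => ?_
      have h1 := (hΦ.measurable k (Q i)).mono (history_mono (r := r) (μ := μ) hk)
      exact Measurable.eventuallyMeasurable_of_eventuallyEq
        h1.stronglyMeasurable_mk.measurable ((hq k i).trans h1.ae_eq_mk)
    · exact condExp_history hμ hr (integrable_indicator_one (sigmaGen_le hμ.measurable _ s hs))
        (stronglyMeasurable_const.indicator hs).aestronglyMeasurable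
  zero_mean w t i := by
    rw [integral_congr_ae (hq.zProc_ae hΦ hμ.p_pos w t i)]
    exact hΦ.integral_eq_zero t _
  wss :=
    { memLp := fun k t => (memLp_congr_ae (hq.zProc_ae hΦ hμ.p_pos k.1 t k.2)).2 (Lp.memLp _)
      mean := fun k t s => by
        rw [integral_congr_ae (hq.zProc_ae hΦ hμ.p_pos k.1 t k.2),
          integral_congr_ae (hq.zProc_ae hΦ hμ.p_pos k.1 s k.2), hΦ.integral_eq_zero,
          hΦ.integral_eq_zero]
      cov := fun k l t s h => by
        rw [← inner_eq_integral (hq.zProc_ae hΦ hμ.p_pos k.1 (t + h) k.2).symm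
            (hq.zProc_ae hΦ hμ.p_pos l.1 (s + h) l.2).symm,
          ← inner_eq_integral (hq.zProc_ae hΦ hμ.p_pos k.1 t k.2).symm
            (hq.zProc_ae hΦ hμ.p_pos l.1 s l.2).symm]
        exact hΦ.inner_shift _ _ t s h }

end Represents

end Representation

/-! ### Linear prediction as projection in the time free space -/

section LinearPrediction

variable {Ω : Type*} [MeasurableSpace Ω] {P : Measure Ω} {κ : Type*}
  {V : Type*} [NormedAddCommGroup V] [InnerProductSpace ℝ V]

theorem measurable_linPred (G : Set (Ω → ℝ)) (z : Ω → κ → ℝ) : Measurable (linPred P G z) := by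
  refine measurable_pi_lambda _ fun i => ?_
  unfold linPred
  split_ifs
  · exact (Lp.stronglyMeasurable _).measurable
  · exact measurable_const

/-- Linear prediction corresponds to orthogonal projection under an isometric embedding into
`L²`. -/
theorem linPred_ae {φ : V →ₗᵢ[ℝ] Lp ℝ 2 P} {G : Set (Ω → ℝ)} {s : Set V}
    (hG : {f : Lp ℝ 2 P | ∃ g ∈ G, f =ᵐ[P] g} = φ '' s) {z : Ω → κ → ℝ} {i : κ} {a b : V}
    (hz : (fun ω => z ω i) =ᵐ[P] φ a) (hb : b ∈ (Submodule.span ℝ s).topologicalClosure)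
    (hab : ∀ c ∈ (Submodule.span ℝ s).topologicalClosure, inner ℝ (a - b) c = 0) :
    (fun ω => linPred P G z ω i) =ᵐ[P] φ b := by
  have hmem : MemLp (fun ω => z ω i) 2 P := (memLp_congr_ae hz).2 (Lp.memLp _)
  have hza : hmem.toLp _ = φ a := Lp.ext (hmem.coeFn_toLp.trans hz)
  have hspan : closedSpan P G = (Submodule.span ℝ (φ '' s)).topologicalClosure := by
    rw [closedSpan, hG]
  have hproj : (closedSpan P G).starProjection (hmem.toLp _) = φ b := by
    rw [hza]
    refine Submodule.eq_starProjection_of_mem_of_inner_eq_zero ?_ fun c hc => ?_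
    · rw [hspan]
      have hle : (Submodule.span ℝ s).topologicalClosure ≤
          (Submodule.span ℝ (φ '' s)).topologicalClosure.comap φ.toLinearMap := by
        refine Submodule.topologicalClosure_minimal _ (Submodule.span_le.2 fun c hc => ?_)
          ((Submodule.isClosed_topologicalClosure _).preimage φ.continuous)
        exact Submodule.le_topologicalClosure _ (Submodule.subset_span ⟨c, hc, rfl⟩)
      exact hle hb
    · rw [hspan] at hc
      refine map_eq_zero_of_mem_closure_span (innerSL ℝ (φ a - φ b)) ?_ hc
      rintro _ ⟨c, hc, rfl⟩
      change inner ℝ (φ a - φ b) (φ c) = 0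
      rw [← map_sub, φ.inner_map_map]
      exact hab c (Submodule.le_topologicalClosure _ (Submodule.subset_span hc))
  simp only [linPred, dif_pos hmem, hproj]
  rfl

end LinearPrediction

/-! ### Translation between systems of processes and of vectors -/

section Translation

variable {Ω : Type*} [m0 : MeasurableSpace Ω] {P : Measure Ω} {d : ℕ}
  {μ : ℤ → Ω → Fin d → ℝ} {E : Set (Fin d × Fin d)} {p : Fin d → ℝ}
  {ι κ : Type*} {r : ℤ → Ω → ι → ℝ}
  {V : Type*} [NormedAddCommGroup V] [InnerProductSpace ℝ V]
  {Φ : ℤ → V →ₗᵢ[ℝ] Lp ℝ 2 P} {T : Fin d → V →L[ℝ] V} {q : ℤ → Ω → κ → ℝ} {Q : κ → V}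

namespace Represents

theorem pastCoords_eq_image (hq : Represents Φ q Q) (hΦ : IsProcessSpace P μ p r Φ T)
    (hp : ∀ σ, 0 < p σ) (t : ℤ) :
    {f : Lp ℝ 2 P | ∃ g ∈ pastCoords μ p q t, f =ᵐ[P] g} =
      Φ t '' {a | ∃ w : List (Fin d), w ≠ [] ∧ ∃ i, a = wordOp T w (Q i)} := by
  ext f
  constructor
  · rintro ⟨_, ⟨w, hw, i, rfl⟩, hf⟩
    exact ⟨_, ⟨w, hw, i, rfl⟩, (Lp.ext (hf.trans (hq.zProc_ae hΦ hp w t i))).symm⟩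
  · rintro ⟨_, ⟨w, hw, i, rfl⟩, rfl⟩
    exact ⟨_, ⟨w, hw, i, rfl⟩, (hq.zProc_ae hΦ hp w t i).symm⟩

theorem pastCoords_union_eq_image (hq : Represents Φ q Q) (hΦ : IsProcessSpace P μ p r Φ T)
    (hp : ∀ σ, 0 < p σ) (t : ℤ) :
    {f : Lp ℝ 2 P | ∃ g ∈ pastCoords μ p q t ∪ coords (q t), f =ᵐ[P] g} =
      Φ t '' {a | ∃ w : List (Fin d), ∃ i, a = wordOp T w (Q i)} := by
  ext f
  constructor
  · rintro ⟨_, ⟨w, hw, i, rfl⟩ | ⟨i, rfl⟩, hf⟩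
    · exact ⟨_, ⟨w, i, rfl⟩, (Lp.ext (hf.trans (hq.zProc_ae hΦ hp w t i))).symm⟩
    · exact ⟨_, ⟨[], i, rfl⟩, (Lp.ext (hf.trans (hq t i))).symm⟩
  · rintro ⟨_, ⟨w, i, rfl⟩, rfl⟩
    rcases eq_or_ne w [] with rfl | hw
    · exact ⟨_, .inr ⟨i, rfl⟩, (hq t i).symm⟩
    · exact ⟨_, .inl ⟨w, hw, i, rfl⟩, (hq.zProc_ae hΦ hp w t i).symm⟩

end Represents

variable {nx nu nn ny : ℕ} {y : ℤ → Ω → Fin ny → ℝ} {u : ℤ → Ω → Fin nu → ℝ}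
  {S : GLSS d nx nu nn ny} {x : ℤ → Ω → Fin nx → ℝ} {v : ℤ → Ω → Fin nn → ℝ}
  {Y : Fin ny → V} {U : Fin nu → V} {X : Fin nx → V} {N : Fin nn → V}

theorem output_ae (hx : Represents Φ x X) (hv : Represents Φ v N) (hu : Represents Φ u U)
    (C : Matrix κ (Fin nx) ℝ) (D : Matrix κ (Fin nu) ℝ) (F : Matrix κ (Fin nn) ℝ) (t : ℤ) (i : κ) :
    Φ t (lc C X i + lc D U i + lc F N i) =ᵐ[P]
      fun ω => (C *ᵥ x t ω + D *ᵥ u t ω + F *ᵥ v t ω) i := by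
  rw [map_add, map_add]
  filter_upwards [hx.lc_ae C t i, hu.lc_ae D t i, hv.lc_ae F t i,
    Lp.coeFn_add (Φ t (lc C X i) + Φ t (lc D U i)) (Φ t (lc F N i)),
    Lp.coeFn_add (Φ t (lc C X i)) (Φ t (lc D U i))] with ω h1 h2 h3 h4 h5
  rw [h4, Pi.add_apply, h5, Pi.add_apply, h1, h2, h3]
  rfl

theorem state_ae (hΦ : IsProcessSpace P μ p r Φ T) (hp : ∀ σ, 0 < p σ) (hx : Represents Φ x X)
    (hv : Represents Φ v N) (hu : Represents Φ u U) (S : GLSS d nx nu nn ny) (t : ℤ)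
    (i : Fin nx) :
    Φ (t + 1) (∑ σ, Real.sqrt (p σ) •
        T σ (lc (S.A σ) X i + lc (S.B σ) U i + lc (S.K σ) N i)) =ᵐ[P]
      fun ω => (∑ σ, μ t ω σ • (S.A σ *ᵥ x t ω + S.B σ *ᵥ u t ω + S.K σ *ᵥ v t ω)) i := by
  have h := ae_all_iff.2 fun σ => output_ae hx hv hu (S.A σ) (S.B σ) (S.K σ) t i
  filter_upwards [hΦ.sum_smul_apply_ae hp
    (fun σ => lc (S.A σ) X i + lc (S.B σ) U i + lc (S.K σ) N i) t, h] with ω h1 h2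
  rw [h1, Finset.sum_apply]
  refine Finset.sum_congr rfl fun σ _ => ?_
  rw [h2 σ]
  rfl

theorem mul_crossCov_apply (hΦ : IsProcessSpace P μ p r Φ T) (hp : ∀ σ, 0 < p σ) {l : Type*}
    [Fintype κ] (hq : Represents Φ q Q) (M : Matrix l κ ℝ) (σ : Fin d) (t : ℤ) (i : l) (k : κ) :
    (M * crossCov P (zProc μ p q [σ] t) (zProc μ p q [σ] t)) i k =
      inner ℝ (lc M (fun j => T σ (Q j)) i) (T σ (Q k)) := by
  rw [Matrix.mul_apply, inner_lc_left]
  exact Finset.sum_congr rfl fun j _ => by rw [hq.crossCov_zProc hq hΦ hp]; rfl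

theorem IsStationaryGLSSDegenerate.represents_output
    (hS : IsStationaryGLSSDegenerate P μ E p y u S x v) (hx : Represents Φ x X)
    (hv : Represents Φ v N) (hu : Represents Φ u U) :
    Represents Φ y fun i => lc S.C X i + lc S.D U i + lc S.F N i := fun t i => by
  refine Filter.EventuallyEq.trans ?_ (output_ae hx hv hu S.C S.D S.F t i).symm
  filter_upwards [hS.output_eq t] with ω h
  rw [h]

theorem IsStationaryGLSSDegenerate.isRealization (hS : IsStationaryGLSSDegenerate P μ E p y u S x v)
    (hΦ : IsProcessSpace P μ p r Φ T) (hp : ∀ σ, 0 < p σ) (hx : Represents Φ x X)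
    (hv : Represents Φ v N) (hu : Represents Φ u U) :
    IsRealization T E (fun σ => Real.sqrt (p σ)) (fun i => lc S.C X i + lc S.D U i + lc S.F N i)
      U S X N where
  state_eq i := by
    -- One time instant is enough, as `Φ` is isometric there.
    apply (Φ (0 + 1)).injective
    apply Lp.ext
    refine Filter.EventuallyEq.trans ?_ (state_ae hΦ hp hx hv hu S 0 i).symm
    filter_upwards [hS.state_eq 0, hx (0 + 1) i] with ω h1 h2
    rw [← h2, h1]
  output_eq _ := rfl
  white w w' hw hw' hww i j := by
    obtain ⟨σ, w', rfl⟩ := List.exists_cons_of_ne_nil hw'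
    rw [← (hv.stack hu).crossCov_zProc (hv.stack hu) hΦ hp w (σ :: w') 0 i j,
      hS.whiteNoise.cov w w' σ 0 hw, if_neg fun h => hww h.1]
    rfl
  noise_input σ i j := by
    have h := congrFun₂ (hS.noise_input σ 0) i j
    rw [hv.crossCov_timesMu hu hΦ hp] at h
    exact (_root_.mul_eq_zero.1 h).resolve_left (hp σ).ne'
  state_noise σ i j := by
    rw [← wordOp_singleton, ← wordOp_singleton T σ (Sum.elim N U j),
      ← hx.crossCov_zProc (hv.stack hu) hΦ hp [σ] [σ] 0 i j, hS.state_noise]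
    rfl
  past_state_noise w hw i j := by
    have h := hx.crossCov_zProc (hv.stack hu) hΦ hp w [] 0 i j
    rw [wordOp_nil] at h
    rw [← h]
    have h' := congrFun₂ (hS.past_state_noise w 0 hw) i j
    refine Eq.trans ?_ h'
    congr 1
    ext ω j
    exact zProc_nil _ _ _ _ _
  mul_eq_zero := hS.mul_eq_zero
  mul_noise_eq_zero σ₁ σ₂ h i k := by
    rw [← mul_crossCov_apply hΦ hp (hv.stack hu) _ σ₁ 0, hS.mul_noise_eq_zero σ₁ σ₂ h]
    rfl

theorem IsRealization.isStationaryGLSSDegenerate [IsProbabilityMeasure P]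
    (hS : IsRealization T E (fun σ => Real.sqrt (p σ)) Y U S X N)
    (hΦ : IsProcessSpace P μ p r Φ T) (hμ : IsAdmissible P μ E p) (hr : IsZMWSSI P μ p r)
    (hx : Represents Φ x X) (hv : Represents Φ v N) (hu : Represents Φ u U)
    (hy : Represents Φ y Y) (hxm : ∀ t, Measurable (x t)) (hvm : ∀ t, Measurable (v t))
    (hum : ∀ t, Measurable (u t))
    (hstable : ∀ z ∈ spectrum ℂ ((∑ σ, p σ • (S.A σ ⊗ₖ S.A σ)).map (algebraMap ℝ ℂ)), ‖z‖ < 1) :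
    IsStationaryGLSSDegenerate P μ E p y u S x v := by
  obtain ⟨a, hT⟩ := hΦ.exists_isSwitchingFamily hμ hr
  have hp := hμ.p_pos
  have hvu := hv.stack hu
  have hvum : ∀ t, Measurable (stack v u t) := fun t => by
    refine measurable_pi_lambda _ ?_
    rintro (i | i)
    · exact (measurable_pi_apply i).comp (hvm t)
    · exact (measurable_pi_apply i).comp (hum t)
  have hxvum : ∀ t, Measurable (stack x (stack v u) t) := fun t => by
    refine measurable_pi_lambda _ ?_
    rintro (i | i)
    · exact (measurable_pi_apply i).comp (hxm t)
    · exact (measurable_pi_apply i).comp (hvum t)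
  exact
  { state_eq := fun t => by
      have h1 := ae_all_iff.2 fun i => hx (t + 1) i
      have h2 := ae_all_iff.2 fun i => state_ae hΦ hp hx hv hu S t i
      filter_upwards [h1, h2] with ω h1 h2
      ext i
      rw [h1 i, hS.state_eq i, h2 i]
    output_eq := fun t => by
      have h1 := ae_all_iff.2 fun i => hy t i
      have h2 := ae_all_iff.2 fun i => output_ae hx hv hu S.C S.D S.F t i
      filter_upwards [h1, h2] with ω h1 h2
      ext i
      rw [h1 i, hS.output_eq i, h2 i]
    whiteNoise :=
      { zmwssi := hvu.isZMWSSI hΦ hμ hr hvum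
        cov := fun w w' σ t hw => by
          ext i j
          rw [hvu.crossCov_zProc hvu hΦ hp]
          split_ifs with h
          · rw [h.1, hT.inner_wordOp_cons_self (h.1 ▸ h.2.2), hvu.crossCov_zProc hvu hΦ hp]
            rfl
          · by_cases hww : w = σ :: w'
            · subst hww
              rw [hT.wordOp_eq_zero_of_not_isChain fun hc => h ⟨rfl, by simp, hc⟩,
                inner_zero_left]
              rfl
            · exact hS.white w (σ :: w') hw (by simp) hww i j }
    noise_input := fun σ t => by
      ext i j
      rw [hv.crossCov_timesMu hu hΦ hp, hS.noise_input, mul_zero]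
      rfl
    zmwssi := (hx.stack hvu).isZMWSSI hΦ hμ hr hxvum
    state_noise := fun σ t => by
      ext i j
      rw [hx.crossCov_zProc hvu hΦ hp]
      exact hS.state_noise σ i j
    past_state_noise := fun w t hw => by
      ext i j
      have h := hx.crossCov_zProc hvu hΦ hp w [] t i j
      refine Eq.trans ?_ (h.trans (hS.past_state_noise w hw i j))
      congr 1
      ext ω j
      exact (zProc_nil _ _ _ _ _).symm
    stable := hstable
    mul_eq_zero := hS.mul_eq_zero
    mul_noise_eq_zero := fun σ₁ σ₂ h t => by
      ext i k
      rw [mul_crossCov_apply hΦ hp hvu]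
      exact hS.mul_noise_eq_zero σ₁ σ₂ h i k }

/-- Uncorrelated noise and input make the joint covariance block diagonal, so regularity can be
checked on the two blocks separately. -/
theorem det_crossCov_stack (hΦ : IsProcessSpace P μ p r Φ T) (hp : ∀ σ, 0 < p σ)
    (hv : Represents Φ v N) (hu : Represents Φ u U) (σ : Fin d)
    (h : ∀ i j, inner ℝ (T σ (N i)) (T σ (U j)) = 0) (t : ℤ) :
    (crossCov P (zProc μ p (stack v u) [σ] t) (zProc μ p (stack v u) [σ] t)).det =
      (crossCov P (zProc μ p v [σ] t) (zProc μ p v [σ] t)).det *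
        (crossCov P (zProc μ p u [σ] t) (zProc μ p u [σ] t)).det := by
  rw [← Matrix.det_fromBlocks_zero₂₁ _ 0]
  congr 1
  have hvu := hv.stack hu
  ext (i | i) (j | j)
  · rfl
  · rw [hvu.crossCov_zProc hvu hΦ hp]
    exact h i j
  · rw [hvu.crossCov_zProc hvu hΦ hp, real_inner_comm]
    exact h j i
  · rfl

theorem crossCov_timesMu_eq_smul (hΦ : IsProcessSpace P μ p r Φ T) (hp : ∀ σ, 0 < p σ)
    (hq : Represents Φ q Q) (σ : Fin d) (t : ℤ) :
    crossCov P (timesMu μ σ q t) (timesMu μ σ q t) =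
      p σ • crossCov P (zProc μ p q [σ] t) (zProc μ p q [σ] t) := by
  ext i j
  rw [hq.crossCov_timesMu hq hΦ hp, Matrix.smul_apply, hq.crossCov_zProc hq hΦ hp, smul_eq_mul]
  rfl

end Translation

end GLSSTheory

/-! ### Existence of the innovation form -/

theorem corollary1 {Ω : Type*} [MeasurableSpace Ω] (P : Measure Ω) [IsProbabilityMeasure P]
    {d nx nu nn ny : ℕ}
    (μ : ℤ → Ω → Fin d → ℝ) (E : Set (Fin d × Fin d)) (p : Fin d → ℝ)
    (hμ : GLSSTheory.IsAdmissible P μ E p)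
    (y : ℤ → Ω → Fin ny → ℝ) (hy : ∀ t, Measurable (y t)) (u : ℤ → Ω → Fin nu → ℝ)
    (S : GLSSTheory.GLSS d nx nu nn ny) (x : ℤ → Ω → Fin nx → ℝ) (v : ℤ → Ω → Fin nn → ℝ)
    (hS : GLSSTheory.IsStationaryGLSSDegenerate P μ E p y u S x v) :
    ∃ (nx' : ℕ) (S' : GLSSTheory.GLSS d nx' nu ny ny) (x' : ℤ → Ω → Fin nx' → ℝ)
      (v' : ℤ → Ω → Fin ny → ℝ),
      GLSSTheory.InInnovationForm P μ p y u S' v' ∧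
      GLSSTheory.IsStationaryGLSSDegenerate P μ E p y u S' x' v' ∧
      (GLSSTheory.IsStationaryGLSS P μ E p y u S x v →
        (∀ σ t, IsUnit (GLSSTheory.crossCov P (GLSSTheory.timesMu μ σ v' t)
          (GLSSTheory.timesMu μ σ v' t)).det) →
        GLSSTheory.IsStationaryGLSS P μ E p y u S' x' v') := by
  open GLSSTheory in
  have hp := hμ.p_pos
  have hr := hS.zmwssi
  obtain ⟨V, Φ, T, R, hV, hΦ, hR⟩ := exists_processSpace hμ hr
  obtain ⟨a, hT⟩ := hΦ.exists_isSwitchingFamily hμ hr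
  have hx : Represents Φ x fun i => R (.inl i) := fun t i => hR t (.inl i)
  have hv : Represents Φ v fun i => R (.inr (.inl i)) := fun t i => hR t (.inr (.inl i))
  have hu : Represents Φ u fun i => R (.inr (.inr i)) := fun t i => hR t (.inr (.inr i))
  have hum : ∀ t, Measurable (u t) := fun t => measurable_pi_lambda _ fun i =>
    (measurable_pi_apply (Sum.inr (Sum.inr i))).comp (hr.measurable t)
  have hYrep := hS.represents_output hx hv hu
  have hreal := hS.isRealization hΦ hp hx hv hu
  set U : Fin nu → V := fun i => R (.inr (.inr i))
  set Y : Fin ny → V := fun i => lc S.C (fun i => R (.inl i)) i + lc S.D U i +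
    lc S.F (fun i => R (.inr (.inl i))) i
  have hcU : CompleteSpace (fullSpan T U) :=
    (Submodule.isClosed_topologicalClosure _).completeSpace_coe
  let Yd : Fin ny → V := fun i => (fullSpan T U).starProjection (Y i)
  let Ys : Fin ny → V := fun i => Y i - Yd i
  have hcY : CompleteSpace (pastSpan T Ys) :=
    (Submodule.isClosed_topologicalClosure _).completeSpace_coe
  let Yp : Fin ny → V := fun i => (pastSpan T Ys).starProjection (Ys i)
  have hYd_mem : ∀ i, Yd i ∈ fullSpan T U := fun i => Submodule.starProjection_apply_mem _ _
  have hYd : ∀ i, ∀ g ∈ fullSpan T U, inner ℝ (Y i - Yd i) g = 0 := fun i g hg =>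
    Submodule.starProjection_inner_eq_zero _ _ hg
  have hYp_mem : ∀ i, Yp i ∈ pastSpan T Ys := fun i => Submodule.starProjection_apply_mem _ _
  have hYp : ∀ i, ∀ g ∈ pastSpan T Ys, inner ℝ (Ys i - Yp i) g = 0 := fun i g hg =>
    Submodule.starProjection_inner_eq_zero _ _ hg
  have hsub : ∀ {q q' : ℤ → Ω → Fin ny → ℝ} {Q Q' : Fin ny → V}, Represents Φ q Q →
      Represents Φ q' Q' → Represents Φ (fun t ω => q t ω - q' t ω) fun i => Q i - Q' i := by
    intro q q' Q Q' hq hq' t i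
    rw [map_sub]
    filter_upwards [hq t i, hq' t i, Lp.coeFn_sub (Φ t (Q i)) (Φ t (Q' i))] with ω h1 h2 h3
    rw [h3, Pi.sub_apply, Pi.sub_apply, h1, h2]
  have hYd_rep : Represents Φ (detComp P μ p y u) Yd := fun t i =>
    linPred_ae (hu.pastCoords_union_eq_image hΦ hp t) (hYrep t i) (hYd_mem i) (hYd i)
  have hYs_rep : Represents Φ (stochComp P μ p y u) Ys := hsub hYrep hYd_rep
  have hYp_rep : Represents Φ (fun t => linPred P (pastCoords μ p (stochComp P μ p y u) t)
      (stochComp P μ p y u t)) Yp := fun t i =>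
    linPred_ae (hYs_rep.pastCoords_eq_image hΦ hp t) (hYs_rep t i) (hYp_mem i) (hYp i)
  have he_rep : Represents Φ (innovation P μ p y u) fun i => Ys i - Yp i := hsub hYs_rep hYp_rep
  have he_meas : ∀ t, Measurable (innovation P μ p y u t) := fun t =>
    ((hy t).sub (measurable_linPred _ _)).sub (measurable_linPred _ _)
  obtain ⟨K, X', hreal'⟩ := hreal.exists_innovation hT hYd_mem hYd (fun _ => rfl) hYp_mem hYp
  -- The new state exists only as `L²` classes; their measurable representatives define the process.
  have hX' : Represents Φ (fun t ω i => Φ t (X' i) ω) X' := fun t i => .refl _ _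
  have hdeg := hreal'.isStationaryGLSSDegenerate hΦ hμ hr hX' he_rep hu hYrep
    (fun t => measurable_pi_lambda _ fun i => (Lp.stronglyMeasurable _).measurable) he_meas hum
    hS.stable
  refine ⟨nx, _, _, _, ⟨rfl, rfl⟩, hdeg, fun hreg he => ⟨hdeg, hdeg.whiteNoise, fun σ t => ?_⟩⟩
  have h1 := hreg.regular.nonsingular σ t
  have h2 := he σ t
  -- The input block is regular because the given joint covariance is; the innovation block is
  -- regular by hypothesis, up to a scalar power of `p σ`.
  rw [det_crossCov_stack hΦ hp hv hu σ (hreal.noise_input σ), IsUnit.mul_iff] at h1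
  rw [crossCov_timesMu_eq_smul hΦ hp he_rep, Matrix.det_smul, IsUnit.mul_iff] at h2
  rw [det_crossCov_stack hΦ hp he_rep hu σ (hreal'.noise_input σ), IsUnit.mul_iff]
  exact ⟨h2.2, h1.2⟩
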